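/- Consider a discrete POMDP with state set $\mathcal X$, finite nonempty action set $\mathcal A$, observation set $\mathcal Z$, initial belief $b_0$, transition law $\mathbb P_T(x'\mid x,a)$, observation law $\mathbb P_Z(z\mid x)$ (all discrete), rewards $|r(x,a)|\le R_{\max}$ and discount $\gamma\in[0,1]$. For a history $h=(a_0,z_1,\dots,a_{d-1},z_d)$ let $b(h)$ be its Bayesian belief, $r(b,a)=\mathbb E_{x\sim b}\,r(x,a)$, and $\mathbb P_Z(z\mid h,a)$ the probability of observing $z$ after action $a$ at belief $b(h)$; $h$ is reachable if all its observations have positive conditional probability. Fix a depth $L$; nodes of the belief tree are histories of length $d\le L$, the root is $b_0$ at depth $0$ and the leaves are at depth $L$. Let $V^*(h)$ be the supremum over deterministic history-dependent policies of the expected discounted reward collected from $h$ at depths $d,\dots,L-1$ (so $V^*=0$ at leaves), and $Q^*(h,a)=r(b(h),a)+\gamma\sum_z\mathbb P_Z(z\mid h,a)V^*(haz)$. Put $V_{\max}=R_{\max}\sum_{i<L}\gamma^i$. Assume that for some $\phi_Z>0$, for every reachable $h$ of depth $<L$ and every $a$, $\mathbb P_Z(\cdot\mid h,a)$ has finite support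 and each $z$ in the support satisfies $\mathbb P_Z(z\mid h,a)\ge\phi_Z$ (hence there are at most $M_Z=\lfloor\phi_Z^{-1}\rfloor$ of them). Let $\Delta_{\min}>0$ be such that $V^*(h)-Q^*(h,a)$ is either $0$ or at least $\Delta_{\min}$, for all reachable $h$ of depth $<L$ and all $a$. Level parameters: $\eta^{(L)}\in[1/2,1)$, $\xi^{(L)}$, and for $h=L-1,\dots,0$ an exponent $\alpha^{(h+1)}$ with $$\xi^{(h+1)}\eta^{(h+1)}(1-\eta^{(h+1)})\le\alpha^{(h+1)}<\xi^{(h+1)}(1-\eta^{(h+1)}),\qquad \xi^{(h)}=\alpha^{(h+1)}-1,\qquad \eta^{(h)}=\frac{\alpha^{(h+1)}}{\xi^{(h+1)}(1-\eta^{(h+1)})},$$ with $\xi^{(L)}$ large enough and the $\alpha^{(h)}$ chosen such that $\alpha^{(1)}>2$; and arbitrary $\beta^{(1)},\dots,\beta^{(L)}>1$. Algorithm (Corrected-POMCP): start with an empty tree. Each simulation draws $x\sim b_0$ and runs $\mathrm{Simulate}(x,\text{root})$. $\mathrm{Simulate}(x,h)$ returns $0$ if $h$ has depth $L$. If $h$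 is not in the tree, $h$ is added with $N(h)=N(h,a)=0$, $Q(h,a)=0$, and the discounted return up to depth $L$ of a rollout from $x$ under an arbitrary fixed history-dependent (possibly randomized) rollout policy is returned. Otherwise, with $d$ the depth of $h$, an action $$a\in\arg\max_{a}\Big\{Q(h,a)+(\beta^{(d+1)})^{1/\xi^{(d+1)}}\,N(h)^{\alpha^{(d+1)}/\xi^{(d+1)}}\,N(h,a)^{-(1-\eta^{(d+1)})}\Big\}$$ is chosen (untried actions have index $+\infty$; ties are broken arbitrarily, possibly at random, on the basis of the current tree), $x'\sim\mathbb P_T(\cdot\mid x,a)$ and $z\sim\mathbb P_Z(\cdot\mid x')$ are drawn, $R=r(x,a)+\gamma\,\mathrm{Simulate}(x',haz)$, then $N(h)$ and $N(h,a)$ increase by $1$, $Q(h,a)$ increases by $(R-Q(h,a))/N(h,a)$, and $R$ is returned. Let $\hat V_n(b_0)$ be the average of the returns of the first $n$ simulations at the root. Then there is a constant $\beta^{(0)}>1$, depending only on $V_{\max},|\mathcal A|,L,\Delta_{\min},\phi_Z$ and the level parameters, such that for all $n\ge1$ and all real $z\ge1$ $$\mathbb P\big(n(\hat V_n(b_0)-V^*(b_0))\ge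 n^{\eta^{(0)}}z\big)\le\beta^{(0)}z^{-\xi^{(0)}},\qquad \mathbb P\big(n(\hat V_n(b_0)-V^*(b_0))\le-n^{\eta^{(0)}}z\big)\le\beta^{(0)}z^{-\xi^{(0)}}.$$ -/

import Mathlib

open scoped ENNReal

/-- A discrete POMDP: states `X`, actions `A`, observations `Z`; all laws are discrete. -/
structure POMDP (X A Z : Type*) where
  /-- initial belief -/
  init : PMF X
  /-- transition model -/
  trans : X → A → PMF X
  /-- observation model -/
  obs : X → PMF Z
  /-- state-dependent reward -/
  reward : X → A → ℝ
  /-- discount factor -/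
  discount : ℝ
  discount_nonneg : 0 ≤ discount
  discount_le_one : discount ≤ 1

/-- An action-observation history, most recent pair first. Its length is the depth of the
corresponding node of the belief tree; the root is `[]`. -/
abbrev History (A Z : Type*) := List (A × Z)

/-- Statistics `N(h)`, `N(h,a)`, `Q(h,a)` stored at a node. -/
structure NodeStats (A : Type*) where
  N : ℕ
  Na : A → ℕ
  Q : A → ℝ

/-- A search tree: `none` means that the history is not in the tree. -/
abbrev SearchTree (A Z : Type*) := History A Z → Option (NodeStats A)

noncomputable section

namespace POMDP

variable {X A Z : Type*} (M : POMDP X A Z)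

/-- Propagated belief. -/
def predict (b : PMF X) (a : A) : PMF X := b.bind fun x => M.trans x a

/-- Law of the next observation, given belief and action. -/
def obsDist (b : PMF X) (a : A) : PMF Z := (M.predict b a).bind M.obs

theorem tsum_predict_mul_obs (b : PMF X) (a : A) (z : Z) :
    ∑' x, M.predict b a x * M.obs x z = M.obsDist b a z := by
  simp [obsDist, PMF.bind_apply]

open Classical in
/-- Bayesian belief update; the value for an observation of probability zero is irrelevant. -/
def updateBelief (b : PMF X) (a : A) (z : Z) : PMF X :=
  if h : M.obsDist b a z = 0 then b
  else PMF.normalize (fun x => M.predict b a x * M.obs x z)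
    (by rw [tsum_predict_mul_obs]; exact h)
    (by rw [tsum_predict_mul_obs]; exact PMF.apply_ne_top _ _)

/-- Belief attached to a history. -/
def belief : History A Z → PMF X
  | [] => M.init
  | (a, z) :: h => M.updateBelief (belief h) a z

/-- Histories that occur with positive probability under some choice of actions. -/
def Reachable : History A Z → Prop
  | [] => True
  | (a, z) :: h => Reachable h ∧ z ∈ (M.obsDist (M.belief h) a).support

/-- `r(b,a) = E_{x ∼ b} r(x,a)`. -/
def beliefReward (b : PMF X) (a : A) : ℝ := ∑' x, (b x).toReal * M.reward x a

/-- Expected discounted reward collected in `m` steps from history `h` by the deterministic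
history-dependent policy `π`. -/
def policyValue (π : History A Z → A) : ℕ → History A Z → ℝ
  | 0, _ => 0
  | m + 1, h => M.beliefReward (M.belief h) (π h) +
      M.discount * ∑' z, (M.obsDist (M.belief h) (π h) z).toReal *
        policyValue π m ((π h, z) :: h)

/-- Optimal value with `m` steps to go: supremum over all policies. -/
def optValue (m : ℕ) (h : History A Z) : ℝ :=
  ⨆ π : History A Z → A, M.policyValue π m h

/-- Optimal action value with `m + 1` steps to go, including the one that executes `a`. -/
def optQ (m : ℕ) (h : History A Z) (a : A) : ℝ :=
  M.beliefReward (M.belief h) a +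
    M.discount * ∑' z, (M.obsDist (M.belief h) a z).toReal * M.optValue m ((a, z) :: h)

/-- At each reachable non-leaf node of the depth-`L` tree and for each action, the observation
law has finite support and every possible observation has probability at least `φ`. -/
def ObsSupport (L : ℕ) (φ : ℝ) : Prop :=
  ∀ h : History A Z, M.Reachable h → h.length < L → ∀ a : A,
    (M.obsDist (M.belief h) a).support.Finite ∧
    ∀ z ∈ (M.obsDist (M.belief h) a).support, φ ≤ (M.obsDist (M.belief h) a z).toReal

/-- `Δ` is a lower bound for all nonzero suboptimality gaps `V^*(h) - Q^*(h,a)` at reachable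
non-leaf nodes of the depth-`L` tree. -/
def GapAtLeast (L : ℕ) (Δ : ℝ) : Prop :=
  ∀ h : History A Z, M.Reachable h → h.length < L → ∀ a : A,
    M.optQ (L - h.length - 1) h a = M.optValue (L - h.length) h ∨
    M.optQ (L - h.length - 1) h a + Δ ≤ M.optValue (L - h.length) h

end POMDP

namespace NodeStats

variable {A : Type*}

/-- Statistics of a freshly expanded node. -/
def fresh : NodeStats A := ⟨0, fun _ => 0, fun _ => 0⟩

open Classical in
/-- Backup of the return `R` of a simulation that chose action `a`. -/
def backup (s : NodeStats A) (a : A) (R : ℝ) : NodeStats A where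
  N := s.N + 1
  Na := Function.update s.Na a (s.Na a + 1)
  Q := Function.update s.Q a (s.Q a + (R - s.Q a) / ((s.Na a + 1 : ℕ) : ℝ))

/-- Corrected UCB index `Q(h,a) + β^{1/ξ} N(h)^{α/ξ} N(h,a)^{-(1-η)}` of a visited action. -/
def ucbIndex (β ξ η α : ℝ) (s : NodeStats A) (a : A) : ℝ :=
  s.Q a + β ^ (1 / ξ) * (s.N : ℝ) ^ (α / ξ) * (s.Na a : ℝ) ^ (-(1 - η))

/-- `a` maximizes the corrected UCB index, where untried actions have index `+∞`. -/
def IsUCBChoice (β ξ η α : ℝ) (s : NodeStats A) (a : A) : Prop :=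
  s.Na a = 0 ∨
    ((∀ a', s.Na a' ≠ 0) ∧ ∀ a', ucbIndex β ξ η α s a' ≤ ucbIndex β ξ η α s a)

end NodeStats

/-- `sel t h` is the law of the action chosen at node `h` of the tree `t`. It is a corrected-UCB
rule if it always picks a maximizer of the index, with the parameters of the child level;
ties may be broken in any way, also at random. -/
def IsCorrectedUCB {A Z : Type*} (L : ℕ) (β ξ η α : ℕ → ℝ)
    (sel : SearchTree A Z → History A Z → PMF A) : Prop :=
  ∀ (t : SearchTree A Z) (h : History A Z) (s : NodeStats A), t h = some s → h.length < L →
    ∀ a ∈ (sel t h).support,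
      NodeStats.IsUCBChoice (β (h.length + 1)) (ξ (h.length + 1)) (η (h.length + 1))
        (α (h.length + 1)) s a

/-- Recursive choice of the level parameters, from the leaves (level `L`) to the root. -/
structure LevelParams (L : ℕ) (ξ η α : ℕ → ℝ) : Prop where
  eta_leaf : 1 / 2 ≤ η L ∧ η L < 1
  alpha_lower : ∀ h < L, ξ (h + 1) * η (h + 1) * (1 - η (h + 1)) ≤ α (h + 1)
  alpha_upper : ∀ h < L, α (h + 1) < ξ (h + 1) * (1 - η (h + 1))
  xi_step : ∀ h < L, ξ h = α (h + 1) - 1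
  eta_step : ∀ h < L, η h = α (h + 1) / (ξ (h + 1) * (1 - η (h + 1)))
  alpha_one : 2 < α 1

namespace POMDP

variable {X A Z : Type*} (M : POMDP X A Z)

/-- Law of the discounted return of an `m`-step rollout from state `x` at history `h`, with
rollout policy `ρ`. -/
def rollout (ρ : History A Z → PMF A) : ℕ → X → History A Z → PMF ℝ
  | 0, _, _ => PMF.pure 0
  | m + 1, x, h =>
      (ρ h).bind fun a => (M.trans x a).bind fun x' => (M.obs x').bind fun z =>
        (rollout ρ m x' ((a, z) :: h)).map fun R => M.reward x a + M.discount * R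

open Classical in
/-- One call of the simulation routine at history `h` with hidden state `x`, `m` steps before the
planning horizon: law of the updated tree and the return. -/
def simulate (ρ : History A Z → PMF A) (sel : SearchTree A Z → History A Z → PMF A) :
    ℕ → X → History A Z → SearchTree A Z → PMF (SearchTree A Z × ℝ)
  | 0, _, _, t => PMF.pure (t, 0)
  | m + 1, x, h, t =>
      match t h with
      | none =>
          (M.rollout ρ (m + 1) x h).map fun R =>
            (Function.update t h (some NodeStats.fresh), R)
      | some s =>
          (sel t h).bind fun a => (M.trans x a).bind fun x' => (M.obs x').bind fun z =>
            (simulate ρ sel m x' ((a, z) :: h) t).map fun p =>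
              (Function.update p.1 h (some (s.backup a (M.reward x a + M.discount * p.2))),
                M.reward x a + M.discount * p.2)

/-- Joint law of the tree and of the sum of the root returns after `n` simulations with planning
horizon `L`, started with the empty tree. -/
def search (ρ : History A Z → PMF A) (sel : SearchTree A Z → History A Z → PMF A) (L : ℕ) :
    ℕ → PMF (SearchTree A Z × ℝ)
  | 0 => PMF.pure (fun _ => none, 0)
  | n + 1 => (search ρ sel L n).bind fun q => M.init.bind fun x =>
      (M.simulate ρ sel L x [] q.1).map fun p => (p.1, q.2 + p.2)

/-- Law of the empirical root value, the average of the first `n` root returns. -/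
def valueEstimate (ρ : History A Z → PMF A) (sel : SearchTree A Z → History A Z → PMF A)
    (L n : ℕ) : PMF ℝ :=
  (M.search ρ sel L n).map fun q => q.2 / n

end POMDP

end

/-! The proof is a backward induction over the depth. The invariant at a reachable node, `NodeTail`,
is a polynomial tail for the sum of the returns minus the number of visits times V^*. It is maximal
in time: it bounds the probability that this deviation ever reaches N^η y while the node has at most
N visits. In this form it can be used at the random times at which a parent has reached its child,
and neither independence nor stationarity of the returns is needed.

From children to an arm (`exists_armTail`): R - Q^* is the one-step deviation r + γV^* - Q^* plus γ
times the deviation of the child's return from V^* (`IsLog.armDev_eq`). The child terms obey the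
invariant, and there are at most 1/φ children. The one-step terms are bounded martingale
differences: actions are chosen from the tree alone, so the hidden state at a node is distributed
according to its belief. An exponential supermartingale then gives a maximal Gaussian tail
(`toOuterMeasure_exists_armSum_ge`), which on the scale N^η with η ≥ 1/2 is smaller than any power.

From arms to their node (`exists_bandit_tail`): outside a bad event a suboptimal arm is pulled at
most u ~ N^e y times, e = α/(ξ(1-η)). After u pulls its error and its bonus are at most Δ/4 each,
while the index of an optimal arm exceeds V^*. Suboptimal arms thus contribute O(N^e y), optimal
ones at most N^η y ≤ N^e y. The union bound over the number s of pulls of an optimal arm costs the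
sum of max(u,s)^(-α), which is O(u^(1-α)). The new exponents e and α-1 are precisely η and ξ of the
next level, and N = n at the root gives the theorem.

Pathwise facts are proved on logs of visits (`IsTrace`, `IsLog`), probabilistic ones on the law
`searchLog` of these logs. -/

/-! ### Expectations with respect to probability mass functions -/

namespace PMF

variable {α β : Type*}

/-- Expectation of an extended nonnegative function. -/
noncomputable def expect (p : PMF α) (f : α → ℝ≥0∞) : ℝ≥0∞ := ∑' a, p a * f a

theorem expect_pure (a : α) (f : α → ℝ≥0∞) : (PMF.pure a).expect f = f a := by
  unfold expect
  rw [tsum_eq_single a]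
  · simp
  · intro b hb
    simp [PMF.pure_apply, hb]

theorem expect_bind (p : PMF α) (q : α → PMF β) (f : β → ℝ≥0∞) :
    (p.bind q).expect f = p.expect fun a => (q a).expect f := by
  unfold expect
  simp_rw [PMF.bind_apply, ← ENNReal.tsum_mul_right, ← ENNReal.tsum_mul_left]
  rw [ENNReal.tsum_comm]
  simp_rw [mul_assoc]

theorem expect_map (p : PMF α) (g : α → β) (f : β → ℝ≥0∞) :
    (p.map g).expect f = p.expect fun a => f (g a) := by
  rw [PMF.map, expect_bind]
  simp [expect_pure]

theorem expect_const (p : PMF α) (c : ℝ≥0∞) : (p.expect fun _ => c) = c := by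
  unfold expect
  rw [ENNReal.tsum_mul_right, PMF.tsum_coe, one_mul]

theorem expect_mono (p : PMF α) {f g : α → ℝ≥0∞} (h : ∀ a, f a ≤ g a) :
    p.expect f ≤ p.expect g :=
  ENNReal.tsum_le_tsum fun a => by gcongr; exact h a

theorem expect_le_of_le (p : PMF α) {f : α → ℝ≥0∞} {c : ℝ≥0∞} (h : ∀ a, f a ≤ c) :
    p.expect f ≤ c :=
  (p.expect_mono h).trans (p.expect_const c).le

theorem expect_const_mul (p : PMF α) (c : ℝ≥0∞) (f : α → ℝ≥0∞) :
    (p.expect fun a => c * f a) = c * p.expect f := by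
  unfold expect
  rw [← ENNReal.tsum_mul_left]
  exact tsum_congr fun a => by ring

theorem toOuterMeasure_le_expect (p : PMF α) (s : Set α) {f : α → ℝ≥0∞}
    (h : ∀ a ∈ s, 1 ≤ f a) : p.toOuterMeasure s ≤ p.expect f := by
  rw [PMF.toOuterMeasure_apply]
  refine ENNReal.tsum_le_tsum fun a => ?_
  by_cases ha : a ∈ s
  · rw [Set.indicator_of_mem ha]
    exact le_mul_of_one_le_right' (h a ha)
  · rw [Set.indicator_of_notMem ha]
    exact zero_le

theorem toOuterMeasure_le_one (p : PMF α) (s : Set α) : p.toOuterMeasure s ≤ 1 :=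
  (p.toOuterMeasure_le_expect s (f := fun _ => 1) (by simp)).trans (p.expect_const 1).le

theorem summable_toReal (p : PMF α) : Summable fun a => (p a).toReal :=
  ENNReal.summable_toReal (by simp [PMF.tsum_coe])

theorem tsum_toReal (p : PMF α) : ∑' a, (p a).toReal = 1 := by
  rw [← ENNReal.tsum_toReal_eq fun a => p.apply_ne_top a, PMF.tsum_coe, ENNReal.toReal_one]

theorem summable_toReal_mul (p : PMF α) {f : α → ℝ} {B : ℝ} (h : ∀ a, |f a| ≤ B) :
    Summable fun a => (p a).toReal * f a := by
  refine Summable.of_norm_bounded (p.summable_toReal.mul_right B) fun a => ?_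
  rw [Real.norm_eq_abs, abs_mul, abs_of_nonneg ENNReal.toReal_nonneg]
  exact mul_le_mul_of_nonneg_left (h a) ENNReal.toReal_nonneg

theorem abs_tsum_toReal_mul_le (p : PMF α) {f : α → ℝ} {B : ℝ} (h : ∀ a, |f a| ≤ B) :
    |∑' a, (p a).toReal * f a| ≤ B := by
  have hs := p.summable_toReal_mul h
  have hB := p.summable_toReal.mul_right B
  have hBs : ∑' a, (p a).toReal * B = B := by rw [tsum_mul_right, p.tsum_toReal, one_mul]
  rw [abs_le]
  constructor
  · have := (hB.neg).tsum_le_tsum (fun a => ?_) hs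
    · rwa [tsum_neg, hBs] at this
    · have := mul_le_mul_of_nonneg_left (abs_le.1 (h a)).1 (ENNReal.toReal_nonneg (a := p a))
      linarith
  · have := hs.tsum_le_tsum
      (fun a => mul_le_mul_of_nonneg_left (abs_le.1 (h a)).2 ENNReal.toReal_nonneg) hB
    rwa [hBs] at this

theorem tsum_toReal_mul_mono (p : PMF α) {f g : α → ℝ} {B : ℝ} (hf : ∀ a, |f a| ≤ B)
    (hg : ∀ a, |g a| ≤ B) (h : ∀ a, f a ≤ g a) :
    ∑' a, (p a).toReal * f a ≤ ∑' a, (p a).toReal * g a :=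
  (p.summable_toReal_mul hf).tsum_le_tsum
    (fun a => mul_le_mul_of_nonneg_left (h a) ENNReal.toReal_nonneg) (p.summable_toReal_mul hg)

theorem integrable_of_bounded [MeasurableSpace α] [DiscreteMeasurableSpace α] (p : PMF α)
    {f : α → ℝ} {B : ℝ} (h : ∀ a, |f a| ≤ B) : MeasureTheory.Integrable f p.toMeasure :=
  MeasureTheory.Integrable.of_bound (Measurable.of_discrete.aestronglyMeasurable) B
    (Filter.Eventually.of_forall h)

theorem tsum_map_toReal_mul (p : PMF α) (g : α → β) {f : β → ℝ} {B : ℝ} (h : ∀ b, |f b| ≤ B) :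
    ∑' b, ((p.map g) b).toReal * f b = ∑' a, (p a).toReal * f (g a) := by
  let : MeasurableSpace α := ⊤
  let : MeasurableSpace β := ⊤
  have h1 := PMF.integral_eq_tsum (p.map g) f ((p.map g).integrable_of_bounded h)
  have h2 := PMF.integral_eq_tsum p (fun a => f (g a)) (p.integrable_of_bounded fun a => h (g a))
  simp only [smul_eq_mul] at h1 h2
  rw [← h1, ← h2, ← PMF.toMeasure_map g p Measurable.of_discrete,
    MeasureTheory.integral_map Measurable.of_discrete.aemeasurable
      Measurable.of_discrete.aestronglyMeasurable]

/-- Hoeffding's lemma for a discrete law. -/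
theorem expect_exp_le (p : PMF α) {f : α → ℝ} {c : ℝ} (h : ∀ a, |f a| ≤ c)
    (hmean : ∑' a, (p a).toReal * f a = 0) (l : ℝ) :
    (p.expect fun a => ENNReal.ofReal (Real.exp (l * f a))) ≤
      ENNReal.ofReal (Real.exp (c ^ 2 * l ^ 2 / 2)) := by
  let : MeasurableSpace α := ⊤
  have hc : 0 ≤ c := by
    obtain ⟨a, -⟩ := p.support_nonempty
    exact (abs_nonneg _).trans (h a)
  have hzero : ∫ a, f a ∂p.toMeasure = 0 := by
    rw [PMF.integral_eq_tsum p f (p.integrable_of_bounded h)]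
    simpa using hmean
  have hsub := ProbabilityTheory.hasSubgaussianMGF_of_mem_Icc_of_integral_eq_zero
    (μ := p.toMeasure) (X := f) (a := -c) (b := c) Measurable.of_discrete.aemeasurable
    (Filter.Eventually.of_forall fun a => abs_le.1 (h a)) hzero
  have hmgf := hsub.mgf_le l
  have hbd : ∀ a, |Real.exp (l * f a)| ≤ Real.exp (|l| * c) := fun a => by
    rw [abs_of_nonneg (Real.exp_nonneg _), Real.exp_le_exp]
    exact (le_abs_self _).trans ((abs_mul _ _).le.trans
      (mul_le_mul_of_nonneg_left (h a) (abs_nonneg _)))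
  -- The variance proxy is the square of half the length of [-c, c].
  have hcoe : (((‖c - -c‖₊ / 2) ^ 2 : NNReal) : ℝ) = c ^ 2 := by
    rw [NNReal.coe_pow, NNReal.coe_div, coe_nnnorm, Real.norm_eq_abs,
      abs_of_nonneg (by linarith)]
    simp
  rw [ProbabilityTheory.mgf, PMF.integral_eq_tsum p _ (p.integrable_of_bounded hbd), hcoe] at hmgf
  refine le_trans (le_of_eq ?_) (ENNReal.ofReal_le_ofReal hmgf)
  rw [ENNReal.ofReal_tsum_of_nonneg (fun a => by positivity)
    (by simpa using p.summable_toReal_mul hbd)]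
  refine tsum_congr fun a => ?_
  rw [smul_eq_mul, ENNReal.ofReal_mul ENNReal.toReal_nonneg,
    ENNReal.ofReal_toReal (p.apply_ne_top a)]

theorem finite_support_card_le (p : PMF α) (hfin : p.support.Finite) {φ : ℝ} (hφ : 0 < φ)
    (h : ∀ a ∈ p.support, φ ≤ (p a).toReal) : hfin.toFinset.card ≤ ⌊1 / φ⌋₊ := by
  apply Nat.le_floor
  rw [le_div_iff₀ hφ]
  calc (hfin.toFinset.card : ℝ) * φ = ∑ _a ∈ hfin.toFinset, φ := by simp
    _ ≤ ∑ a ∈ hfin.toFinset, (p a).toReal :=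
        Finset.sum_le_sum fun a ha => h a (hfin.mem_toFinset.1 ha)
    _ ≤ ∑' a, (p a).toReal :=
        p.summable_toReal.sum_le_tsum _ fun a _ => ENNReal.toReal_nonneg
    _ = 1 := p.tsum_toReal

end PMF

/-! ### Values -/

namespace POMDP

variable {X A Z : Type*} (M : POMDP X A Z)

/-- Bound for the return of `m` steps with rewards bounded by `R`. -/
noncomputable def horizonBound (R : ℝ) (m : ℕ) : ℝ := R * ∑ i ∈ Finset.range m, M.discount ^ i

theorem horizonBound_succ (R : ℝ) (m : ℕ) :
    M.horizonBound R (m + 1) = R + M.discount * M.horizonBound R m := by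
  unfold horizonBound
  rw [Finset.sum_range_succ', pow_zero, mul_add, mul_one, add_comm, mul_left_comm,
    Finset.mul_sum (a := M.discount)]
  simp only [pow_succ']

theorem horizonBound_mono {R : ℝ} (hR : 0 ≤ R) {m n : ℕ} (h : m ≤ n) :
    M.horizonBound R m ≤ M.horizonBound R n :=
  mul_le_mul_of_nonneg_left (Finset.sum_le_sum_of_subset_of_nonneg
    (Finset.range_mono h) fun i _ _ => pow_nonneg M.discount_nonneg i) hR

variable {M} {R : ℝ}

theorem rewardBound_nonneg [Nonempty A] (hR : ∀ x a, |M.reward x a| ≤ R) : 0 ≤ R := by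
  obtain ⟨x, -⟩ := M.init.support_nonempty
  exact (abs_nonneg _).trans (hR x (Classical.arbitrary A))

theorem abs_reward_add_le (hR : ∀ x a, |M.reward x a| ≤ R) {m : ℕ} {v : ℝ}
    (hv : |v| ≤ M.horizonBound R m) (x : X) (a : A) :
    |M.reward x a + M.discount * v| ≤ M.horizonBound R (m + 1) := by
  rw [horizonBound_succ]
  refine (abs_add_le _ _).trans (add_le_add (hR x a) ?_)
  rw [abs_mul, abs_of_nonneg M.discount_nonneg]
  exact mul_le_mul_of_nonneg_left hv M.discount_nonneg

theorem abs_beliefReward_le (hR : ∀ x a, |M.reward x a| ≤ R) (b : PMF X) (a : A) :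
    |M.beliefReward b a| ≤ R :=
  b.abs_tsum_toReal_mul_le fun x => hR x a

theorem abs_policyValue_le (hR : ∀ x a, |M.reward x a| ≤ R) (π : History A Z → A) (m : ℕ)
    (h : History A Z) : |M.policyValue π m h| ≤ M.horizonBound R m := by
  induction m generalizing h with
  | zero => simp [policyValue, horizonBound]
  | succ m ih =>
    rw [policyValue, horizonBound_succ]
    refine (abs_add_le _ _).trans (add_le_add (abs_beliefReward_le hR _ _) ?_)
    rw [abs_mul, abs_of_nonneg M.discount_nonneg]
    exact mul_le_mul_of_nonneg_left (PMF.abs_tsum_toReal_mul_le _ fun z => ih _)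
      M.discount_nonneg

theorem policyValue_le_optValue (hR : ∀ x a, |M.reward x a| ≤ R) (π : History A Z → A) (m : ℕ)
    (h : History A Z) : M.policyValue π m h ≤ M.optValue m h :=
  le_ciSup (f := fun π : History A Z → A => M.policyValue π m h)
    ⟨M.horizonBound R m, by
      rintro _ ⟨π', rfl⟩
      exact (abs_le.1 (abs_policyValue_le hR π' m h)).2⟩ π

theorem abs_optValue_le [Nonempty A] (hR : ∀ x a, |M.reward x a| ≤ R) (m : ℕ)
    (h : History A Z) : |M.optValue m h| ≤ M.horizonBound R m := by
  let π : History A Z → A := fun _ => Classical.arbitrary A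
  rw [abs_le]
  exact ⟨(abs_le.1 (abs_policyValue_le hR π m h)).1.trans (policyValue_le_optValue hR π m h),
    ciSup_le fun π' => (abs_le.1 (abs_policyValue_le hR π' m h)).2⟩

theorem optValue_zero [Nonempty A] (h : History A Z) : M.optValue 0 h = 0 := by
  simp [optValue, policyValue]

theorem abs_optQ_le [Nonempty A] (hR : ∀ x a, |M.reward x a| ≤ R) (m : ℕ)
    (h : History A Z) (a : A) : |M.optQ m h a| ≤ M.horizonBound R (m + 1) := by
  rw [optQ, horizonBound_succ]
  refine (abs_add_le _ _).trans (add_le_add (abs_beliefReward_le hR _ _) ?_)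
  rw [abs_mul, abs_of_nonneg M.discount_nonneg]
  exact mul_le_mul_of_nonneg_left (PMF.abs_tsum_toReal_mul_le _ fun z => abs_optValue_le hR _ _)
    M.discount_nonneg

/-- Some action attains at least the optimal value. -/
theorem exists_optValue_le_optQ [Finite A] [Nonempty A] (hR : ∀ x a, |M.reward x a| ≤ R)
    (m : ℕ) (h : History A Z) : ∃ a, M.optValue (m + 1) h ≤ M.optQ m h a := by
  obtain ⟨a, ha⟩ := Finite.exists_max fun a => M.optQ m h a
  refine ⟨a, ciSup_le fun π => le_trans ?_ (ha (π h))⟩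
  rw [policyValue, optQ]
  refine add_le_add le_rfl (mul_le_mul_of_nonneg_left ?_ M.discount_nonneg)
  exact PMF.tsum_toReal_mul_mono _ (fun z => abs_policyValue_le hR π m _)
    (fun z => abs_optValue_le hR m _) fun z => policyValue_le_optValue hR π m _

/-! ### Bayesian updates -/

/-- Bayes' rule with the denominator cleared, so that it also covers observations of probability
zero, where both sides vanish. -/
theorem updateBelief_apply_mul (b : PMF X) (a : A) (z : Z) (x : X) :
    M.obsDist b a z * M.updateBelief b a z x = M.predict b a x * M.obs x z := by
  unfold updateBelief
  have hle : M.predict b a x * M.obs x z ≤ M.obsDist b a z := by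
    rw [← tsum_predict_mul_obs]
    exact ENNReal.le_tsum x
  split_ifs with h
  · rw [h] at hle ⊢
    rw [zero_mul]
    exact (le_antisymm hle zero_le).symm
  · rw [PMF.normalize_apply, tsum_predict_mul_obs, mul_comm, mul_assoc,
      ENNReal.inv_mul_cancel h (PMF.apply_ne_top _ _), mul_one]

/-- Drawing the next state and then the observation amounts to drawing the observation and then
the next state from the updated belief. -/
theorem expect_trans_obs (b : PMF X) (a : A) (f : X → Z → ℝ≥0∞) :
    (b.expect fun x => (M.trans x a).expect fun x' => (M.obs x').expect fun z => f x' z) =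
      (M.obsDist b a).expect fun z => (M.updateBelief b a z).expect fun x' => f x' z := by
  rw [← PMF.expect_bind]
  change (M.predict b a).expect _ = _
  unfold PMF.expect
  simp_rw [← ENNReal.tsum_mul_left]
  rw [ENNReal.tsum_comm]
  refine tsum_congr fun z => tsum_congr fun x' => ?_
  rw [← mul_assoc, ← mul_assoc, updateBelief_apply_mul]

/-- Propagates "the hidden state lies in the support of the belief" along a simulation; hence almost
surely only possible observations occur. -/
theorem mem_support_updateBelief {b : PMF X} {a : A} {x x' : X} {z : Z} (hx : x ∈ b.support)
    (hx' : x' ∈ (M.trans x a).support) (hz : z ∈ (M.obs x').support) :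
    z ∈ (M.obsDist b a).support ∧ x' ∈ (M.updateBelief b a z).support := by
  have hp : x' ∈ (M.predict b a).support := (PMF.mem_support_bind_iff _ _ _).2 ⟨x, hx, hx'⟩
  refine ⟨(PMF.mem_support_bind_iff _ _ _).2 ⟨x', hp, hz⟩, fun h0 => ?_⟩
  have := updateBelief_apply_mul (M := M) b a z x'
  rw [h0, mul_zero] at this
  exact mul_ne_zero hp hz this.symm

end POMDP

/-! ### Traces of simulations -/

/-- Record of the visit of a node: the node, the hidden state, action and observation (`none` if
the node was expanded and a rollout was run), and the return. -/
abbrev Visit (X A Z : Type*) := History A Z × Option (X × A × Z) × ℝ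

namespace POMDP

variable {X A Z : Type*} (M : POMDP X A Z)

/-- Return of a simulation, read off at its first node. -/
def traceReturn : List (Visit X A Z) → ℝ
  | [] => 0
  | e :: _ => e.2.2

open Classical in
/-- Effect of a simulation on the tree. -/
noncomputable def applyTrace (t : SearchTree A Z) : List (Visit X A Z) → SearchTree A Z
  | [] => t
  | (h, none, _) :: τ => Function.update (applyTrace t τ) h (some NodeStats.fresh)
  | (h, some (_, a, _), R) :: τ =>
      Function.update (applyTrace t τ) h ((t h).map fun s => s.backup a R)

/-- Tree after a list of simulations, most recent first. -/
noncomputable def treeOf : List (List (Visit X A Z)) → SearchTree A Z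
  | [] => fun _ => none
  | τ :: ω => applyTrace (treeOf ω) τ

/-- Law of the trace of one simulation. -/
noncomputable def simTrace (ρ : History A Z → PMF A)
    (sel : SearchTree A Z → History A Z → PMF A) :
    ℕ → X → History A Z → SearchTree A Z → PMF (List (Visit X A Z))
  | 0, _, _, _ => PMF.pure []
  | m + 1, x, h, t =>
      match t h with
      | none => (M.rollout ρ (m + 1) x h).map fun R => [(h, none, R)]
      | some _ =>
          (sel t h).bind fun a => (M.trans x a).bind fun x' => (M.obs x').bind fun z =>
            (simTrace ρ sel m x' ((a, z) :: h) t).map fun τ =>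
              (h, some (x, a, z), M.reward x a + M.discount * traceReturn τ) :: τ

/-- Law of the traces of the first `n` simulations, most recent first. -/
noncomputable def searchLog (ρ : History A Z → PMF A)
    (sel : SearchTree A Z → History A Z → PMF A) (L : ℕ) :
    ℕ → PMF (List (List (Visit X A Z)))
  | 0 => PMF.pure []
  | n + 1 => (searchLog ρ sel L n).bind fun ω => M.init.bind fun x =>
      (M.simTrace ρ sel L x [] (treeOf ω)).map fun τ => τ :: ω

variable (ρ : History A Z → PMF A) (sel : SearchTree A Z → History A Z → PMF A)

/-- The tree forgets hidden states and observations, which the martingale argument needs. The trace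
keeps them, and both the tree and the return are functions of it. -/
theorem simulate_eq_map_simTrace (m : ℕ) (x : X) (h : History A Z) (t : SearchTree A Z) :
    M.simulate ρ sel m x h t =
      (M.simTrace ρ sel m x h t).map fun τ => (applyTrace t τ, traceReturn τ) := by
  induction m generalizing x h with
  | zero => simp [simulate, simTrace, PMF.pure_map, applyTrace, traceReturn]
  | succ m ih =>
    rw [simulate, simTrace]
    cases ht : t h with
    | none =>
      simp only [PMF.map_comp]
      rfl
    | some s =>
      simp only [PMF.map_bind, ih, PMF.map_comp]
      congr! 8
      ext1 τ
      simp [applyTrace, traceReturn, ht]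

theorem search_eq_map_searchLog (L n : ℕ) :
    M.search ρ sel L n =
      (M.searchLog ρ sel L n).map fun ω => (treeOf ω, (ω.map traceReturn).sum) := by
  induction n with
  | zero => simp [search, searchLog, PMF.pure_map, treeOf]
  | succ n ih =>
    rw [search, searchLog, ih]
    simp only [PMF.map_bind, PMF.bind_map, PMF.map_comp, simulate_eq_map_simTrace,
      Function.comp_def, treeOf, List.map_cons, List.sum_cons, add_comm]

/-! ### Traces of positive probability -/

/-- The traces that a simulation from node `h`, `m` steps before the horizon, can produce. -/
inductive IsTrace (R : ℝ) (t : SearchTree A Z) :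
    ℕ → History A Z → List (Visit X A Z) → Prop
  | leaf (h : History A Z) : IsTrace R t 0 h []
  | expand (m : ℕ) (h : History A Z) (r : ℝ) (ht : t h = none)
      (hr : |r| ≤ M.horizonBound R (m + 1)) : IsTrace R t (m + 1) h [(h, none, r)]
  | step (m : ℕ) (h : History A Z) (s : NodeStats A) (x : X) (a : A) (z : Z)
      (τ : List (Visit X A Z)) (ht : t h = some s) (ha : a ∈ (sel t h).support)
      (hz : z ∈ (M.obsDist (M.belief h) a).support)
      (hτ : IsTrace R t m ((a, z) :: h) τ) :
      IsTrace R t (m + 1) h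
        ((h, some (x, a, z), M.reward x a + M.discount * traceReturn τ) :: τ)

variable {M ρ sel} {R : ℝ}

theorem abs_rollout_le (hR : ∀ x a, |M.reward x a| ≤ R) (m : ℕ) (x : X) (h : History A Z) :
    ∀ r ∈ (M.rollout ρ m x h).support, |r| ≤ M.horizonBound R m := by
  induction m generalizing x h with
  | zero => simp [rollout, horizonBound]
  | succ m ih =>
    intro r hr
    simp only [rollout, PMF.mem_support_bind_iff, PMF.mem_support_map_iff] at hr
    obtain ⟨a, -, x', -, z, -, v, hv, rfl⟩ := hr
    exact abs_reward_add_le hR (ih x' _ v hv) x a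

theorem isTrace_of_mem_support (hR : ∀ x a, |M.reward x a| ≤ R) {t : SearchTree A Z} (m : ℕ)
    (x : X) (h : History A Z) (hx : x ∈ (M.belief h).support) :
    ∀ τ ∈ (M.simTrace ρ sel m x h t).support, M.IsTrace sel R t m h τ := by
  induction m generalizing x h with
  | zero =>
    intro τ hτ
    simp only [simTrace, PMF.support_pure, Set.mem_singleton_iff] at hτ
    subst hτ
    exact .leaf h
  | succ m ih =>
    intro τ hτ
    rw [simTrace] at hτ
    split at hτ
    · rename_i ht
      obtain ⟨r, hr, rfl⟩ := (PMF.mem_support_map_iff _ _ _).1 hτ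
      exact .expand m h r ht (abs_rollout_le hR _ _ _ r hr)
    · rename_i s ht
      simp only [PMF.mem_support_bind_iff, PMF.mem_support_map_iff] at hτ
      obtain ⟨a, ha, x', hx', z, hz, τ', hτ', rfl⟩ := hτ
      obtain ⟨h1, h2⟩ := mem_support_updateBelief hx hx' hz
      exact .step m h s x a z τ' ht ha h1 (ih x' ((a, z) :: h) h2 τ' hτ')

/-- The logs that a search can produce. -/
inductive IsLog (M : POMDP X A Z) (sel : SearchTree A Z → History A Z → PMF A) (R : ℝ) (L : ℕ) :
    List (List (Visit X A Z)) → Prop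
  | nil : IsLog M sel R L []
  | cons (τ : List (Visit X A Z)) (ω : List (List (Visit X A Z))) (hω : IsLog M sel R L ω)
      (hτ : M.IsTrace sel R (treeOf ω) L [] τ) : IsLog M sel R L (τ :: ω)

theorem isLog_of_mem_support (hR : ∀ x a, |M.reward x a| ≤ R) (L n : ℕ) :
    ∀ ω ∈ (M.searchLog ρ sel L n).support, IsLog M sel R L ω ∧ ω.length = n := by
  induction n with
  | zero =>
    intro ω hω
    simp only [searchLog, PMF.support_pure, Set.mem_singleton_iff] at hω
    subst hω
    exact ⟨.nil, rfl⟩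
  | succ n ih =>
    intro ω hω
    simp only [searchLog, PMF.mem_support_bind_iff, PMF.mem_support_map_iff] at hω
    obtain ⟨ω', hω', x, hx, τ, hτ, rfl⟩ := hω
    exact ⟨.cons τ ω' (ih ω' hω').1 (isTrace_of_mem_support hR L x [] hx τ hτ),
      by simp [(ih ω' hω').2]⟩

/-- Logs have the most recent simulation first, so suffixes are the logs at earlier times; "at some
time" is expressed below by a suffix. -/
theorem IsLog.of_suffix {L : ℕ} {ω ω' : List (List (Visit X A Z))} (h : IsLog M sel R L ω)
    (hs : ω' <:+ ω) : IsLog M sel R L ω' := by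
  induction h with
  | nil => rw [List.suffix_nil.1 hs]; exact .nil
  | cons τ ω hω hτ ih =>
    rcases List.suffix_cons_iff.1 hs with rfl | hs
    · exact .cons τ ω hω hτ
    · exact ih hs

/-! ### Statistics of a node -/

open Classical in
/-- Visits of the node `h`, in a list of visits. -/
noncomputable def atNode (h : History A Z) (τ : List (Visit X A Z)) :
    List (Option (X × A × Z) × ℝ) :=
  (τ.filter fun e => e.1 = h).map Prod.snd

/-- Sum of the returns of the visits. -/
noncomputable def retSum (l : List (Option (X × A × Z) × ℝ)) : ℝ := (l.map Prod.snd).sum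

open Classical in
/-- Sum of `f x z r` over the visits in which action `a` was chosen, with hidden state `x`,
observation `z` and return `r`. -/
noncomputable def armSum {B : Type*} [AddCommMonoid B] (a : A) (f : X → Z → ℝ → B)
    (l : List (Option (X × A × Z) × ℝ)) : B :=
  (l.map fun e => match e.1 with
    | none => 0
    | some (x, a', z) => if a' = a then f x z e.2 else 0).sum

/-- Number of visits in which `a` was chosen. -/
noncomputable def pulls (a : A) (l : List (Option (X × A × Z) × ℝ)) : ℕ :=
  armSum a (fun _ _ _ => 1) l

/-- Sum of the returns of the visits in which `a` was chosen. -/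
noncomputable def armRet (a : A) (l : List (Option (X × A × Z) × ℝ)) : ℝ :=
  armSum a (fun _ _ r => r) l

section
variable {B : Type*} [AddCommMonoid B] (a : A) (f : X → Z → ℝ → B)
  (l l' : List (Option (X × A × Z) × ℝ))

theorem armSum_nil : armSum a f [] = 0 := by simp [armSum]

theorem armSum_append : armSum a f (l ++ l') = armSum a f l + armSum a f l' := by
  simp [armSum]

theorem armSum_none (r : ℝ) : armSum a f [((none : Option (X × A × Z)), r)] = 0 := by
  simp [armSum]

open Classical in
theorem armSum_some (x : X) (a' : A) (z : Z) (r : ℝ) :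
    armSum a f [(some (x, a', z), r)] = if a' = a then f x z r else 0 := by
  simp [armSum]

theorem retSum_append : retSum (l ++ l') = retSum l + retSum l' := by
  simp [retSum]

theorem atNode_append (h : History A Z) (τ τ' : List (Visit X A Z)) :
    atNode h (τ ++ τ') = atNode h τ ++ atNode h τ' := by
  simp [atNode]

theorem atNode_cons_self (h : History A Z) (v : Option (X × A × Z) × ℝ)
    (τ : List (Visit X A Z)) : atNode h ((h, v) :: τ) = v :: atNode h τ := by
  simp [atNode]

theorem atNode_cons_ne {h g : History A Z} (hne : g ≠ h) (v : Option (X × A × Z) × ℝ)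
    (τ : List (Visit X A Z)) : atNode h ((g, v) :: τ) = atNode h τ := by
  simp [atNode, hne]

end

/-- A simulation strictly descends from `g`. In particular it visits each node at most once. -/
theorem IsTrace.atNode_eq_nil {t : SearchTree A Z} {m : ℕ} {g h : History A Z}
    {τ : List (Visit X A Z)} (hτ : M.IsTrace sel R t m g τ) (hlt : h.length ≤ g.length)
    (hne : h ≠ g) : atNode h τ = [] := by
  induction hτ with
  | leaf g => rfl
  | expand m g r ht hr => rw [atNode_cons_ne hne.symm]; rfl
  | step m g s x a z τ ht ha hz hτ ih =>
    rw [atNode_cons_ne hne.symm]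
    refine ih (by simp; omega) fun he => ?_
    rw [he] at hlt
    simp at hlt

theorem IsTrace.retSum_atNode_start {t : SearchTree A Z} {m : ℕ} {g : History A Z}
    {τ : List (Visit X A Z)} (hτ : M.IsTrace sel R t m g τ) :
    retSum (atNode g τ) = traceReturn τ ∧ (0 < m → (atNode g τ).length = 1) ∧
      (m = 0 → atNode g τ = []) := by
  cases hτ with
  | leaf => simp [atNode, retSum, traceReturn]
  | expand m _ r ht hr => rw [atNode_cons_self]; simp [atNode, retSum, traceReturn]
  | step m _ s x a z τ ht ha hz hτ =>
    rw [atNode_cons_self, hτ.atNode_eq_nil (by simp) (by simp)]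
    simp [retSum, traceReturn]

theorem IsTrace.abs_traceReturn_le (hR : ∀ x a, |M.reward x a| ≤ R) {t : SearchTree A Z} {m : ℕ}
    {g : History A Z} {τ : List (Visit X A Z)} (hτ : M.IsTrace sel R t m g τ) :
    |traceReturn τ| ≤ M.horizonBound R m := by
  induction hτ with
  | leaf => simp [traceReturn, horizonBound]
  | expand m g r ht hr => exact hr
  | step m g s x a z τ ht ha hz hτ ih => exact abs_reward_add_le hR ih x a

/-- What a simulation does at a given node. -/
theorem IsTrace.atNode_cases [Nonempty A] (hR : ∀ x a, |M.reward x a| ≤ R) {t : SearchTree A Z}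
    {m : ℕ} {g : History A Z} {τ : List (Visit X A Z)} (hτ : M.IsTrace sel R t m g τ)
    (h : History A Z) :
    (atNode h τ = [] ∧ applyTrace t τ h = t h) ∨
    (∃ r, atNode h τ = [(none, r)] ∧ t h = none ∧ applyTrace t τ h = some NodeStats.fresh ∧
      |r| ≤ M.horizonBound R m) ∨
    ∃ x a z r s, atNode h τ = [(some (x, a, z), r)] ∧ t h = some s ∧
      a ∈ (sel t h).support ∧ applyTrace t τ h = some (s.backup a r) ∧
      |r| ≤ M.horizonBound R m := by
  classical
  have hR0 := rewardBound_nonneg hR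
  induction hτ with
  | leaf => exact Or.inl ⟨rfl, rfl⟩
  | expand m g r ht hr =>
    by_cases hg : g = h
    · subst hg
      exact Or.inr (Or.inl ⟨r, by rw [atNode_cons_self]; rfl, ht, by simp [applyTrace], hr⟩)
    · exact Or.inl ⟨by rw [atNode_cons_ne hg]; rfl,
        by simp [applyTrace, Function.update_of_ne (Ne.symm hg)]⟩
  | step m g s x a z τ ht ha hz hτ ih =>
    by_cases hg : g = h
    · subst hg
      refine Or.inr (Or.inr ⟨x, a, z, _, s, ?_, ht, ha, ?_, (hτ.step m g s x a z τ ht ha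
        hz).abs_traceReturn_le hR⟩)
      · rw [atNode_cons_self, hτ.atNode_eq_nil (by simp) (by simp)]
        rfl
      · simp [applyTrace, ht, traceReturn]
    · rw [atNode_cons_ne hg, applyTrace, Function.update_of_ne (Ne.symm hg)]
      have hmono := M.horizonBound_mono hR0 (Nat.le_succ m)
      rcases ih with h1 | ⟨r, h1, h2, h3, h4⟩ | ⟨x, a, z, r, s, h1, h2, h3, h4, h5⟩
      · exact Or.inl h1
      · exact Or.inr (Or.inl ⟨r, h1, h2, h3, h4.trans hmono⟩)
      · exact Or.inr (Or.inr ⟨x, a, z, r, s, h1, h2, h3, h4, h5.trans hmono⟩)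

section
variable [Fintype A]

/-- The statistics stored in the tree are those of the log. -/
theorem IsLog.treeOf_eq [Nonempty A] (hR : ∀ x a, |M.reward x a| ≤ R) {L : ℕ}
    {ω : List (List (Visit X A Z))} (hω : IsLog M sel R L ω) (h : History A Z) :
    (treeOf ω h = none ∧ atNode h ω.flatten = []) ∨
    ∃ s r, treeOf ω h = some s ∧ |r| ≤ M.horizonBound R L ∧
      (∀ a, s.Na a = pulls a (atNode h ω.flatten)) ∧
      s.N = ∑ a, pulls a (atNode h ω.flatten) ∧
      (∀ a, s.Na a * s.Q a = armRet a (atNode h ω.flatten)) ∧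
      (atNode h ω.flatten).length = (∑ a, pulls a (atNode h ω.flatten)) + 1 ∧
      retSum (atNode h ω.flatten) = (∑ a, armRet a (atNode h ω.flatten)) + r := by
  classical
  induction hω with
  | nil => exact Or.inl ⟨rfl, rfl⟩
  | cons τ ω hω hτ ih =>
    simp only [List.flatten_cons, atNode_append, treeOf, pulls, armRet, armSum_append,
      retSum_append, List.length_append, Finset.sum_add_distrib] at ih ⊢
    rcases hτ.atNode_cases hR h with ⟨h1, h2⟩ | ⟨r, h1, h2, h3, h4⟩ |
      ⟨x, a, z, r, s, h1, h2, -, h3, h4⟩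
    · simpa [h1, h2, armSum_nil, retSum] using ih
    -- The expanding visit pulls no action, but counts as a visit and has a rollout return: this is
    -- the source of the `+ 1` and of the extra term `r`.
    · rcases ih with ⟨-, ih2⟩ | ⟨s, -, ih1, -⟩
      · refine Or.inr ⟨_, r, h3, h4, ?_⟩
        simp [h1, ih2, armSum_nil, armSum_none, retSum, NodeStats.fresh]
      · rw [h2] at ih1
        cases ih1
    · rcases ih with ⟨ih1, -⟩ | ⟨s', r', ih1, ih2, ih3, ih4, ih5, ih6, ih7⟩
      · rw [h2] at ih1
        cases ih1
      · rw [h2, Option.some_inj] at ih1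
        subst ih1
        refine Or.inr ⟨_, r', h3, ih2, fun b => ?_, ?_, fun b => ?_, ?_, ?_⟩
        · by_cases hb : b = a
          · subst hb
            simp [NodeStats.backup, h1, armSum_some, ih3, add_comm]
          · simp [NodeStats.backup, h1, armSum_some, ih3, hb, Ne.symm hb]
        · simp [NodeStats.backup, h1, armSum_some, ih4, add_comm]
        · by_cases hb : b = a
          · subst hb
            have h0 : ((s.Na b : ℝ) + 1) ≠ 0 := by positivity
            simp only [NodeStats.backup, Function.update_self, h1, armSum_some, if_true, ← ih5]
            push_cast
            field_simp
            ring
          · simp [NodeStats.backup, h1, armSum_some, ih5, hb, Ne.symm hb]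
        · simp [h1, armSum_some, ih6]
          ring
        · rw [ih7]
          simp [h1, armSum_some, retSum]
          ring

end

/-! ### Deviations from the optimal values and their propagation along the tree -/

variable (M)

/-- Deviation of the one-step target `r(x,a) + γ V^*(haz)` from `Q^*(h,a)`. -/
noncomputable def targetDev (L : ℕ) (h : History A Z) (a : A) (x : X) (z : Z) : ℝ :=
  M.reward x a + M.discount * M.optValue (L - h.length - 1) ((a, z) :: h) -
    M.optQ (L - h.length - 1) h a

/-- Accumulated deviation of the returns at node `h` from the optimal value. -/
noncomputable def nodeDev (L : ℕ) (h : History A Z) (τ : List (Visit X A Z)) : ℝ :=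
  retSum (atNode h τ) - (atNode h τ).length * M.optValue (L - h.length) h

/-- Accumulated deviation of the returns of action `a` at node `h` from `Q^*(h,a)`. -/
noncomputable def armDev (L : ℕ) (h : History A Z) (a : A) (τ : List (Visit X A Z)) : ℝ :=
  armRet a (atNode h τ) - pulls a (atNode h τ) * M.optQ (L - h.length - 1) h a

variable {M}

theorem nodeDev_append (L : ℕ) (h : History A Z) (τ τ' : List (Visit X A Z)) :
    M.nodeDev L h (τ ++ τ') = M.nodeDev L h τ + M.nodeDev L h τ' := by
  simp only [nodeDev, atNode_append, retSum_append, List.length_append]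
  push_cast
  ring

theorem armDev_append (L : ℕ) (h : History A Z) (a : A) (τ τ' : List (Visit X A Z)) :
    M.armDev L h a (τ ++ τ') = M.armDev L h a τ + M.armDev L h a τ' := by
  simp only [armDev, atNode_append, armRet, pulls, armSum_append]
  push_cast
  ring

theorem nodeDev_eq_zero (L : ℕ) {h : History A Z} {τ : List (Visit X A Z)}
    (hn : atNode h τ = []) : M.nodeDev L h τ = 0 := by
  simp [nodeDev, hn, retSum]

theorem armDev_eq_zero (L : ℕ) {h : History A Z} (a : A) {τ : List (Visit X A Z)}
    (hn : atNode h τ = []) : M.armDev L h a τ = 0 := by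
  simp [armDev, hn, armRet, pulls, armSum_nil]

theorem IsTrace.nodeDev_start [Nonempty A] {t : SearchTree A Z} {L m : ℕ} {g : History A Z}
    {τ : List (Visit X A Z)} (hτ : M.IsTrace sel R t m g τ) (hL : m + g.length = L) :
    M.nodeDev L g τ = traceReturn τ - M.optValue (L - g.length) g := by
  obtain ⟨h1, h2, h3⟩ := hτ.retSum_atNode_start
  rw [nodeDev, h1]
  rcases Nat.eq_zero_or_pos m with hm | hm
  -- A leaf is not recorded as a visit, but its return and its optimal value are both zero.
  · have : L - g.length = 0 := by omega
    rw [this, optValue_zero]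
    simp
  · rw [h2 hm]
    simp

/-- The deviation of an arm splits into the one-step deviations and those of the children. -/
theorem IsTrace.armDev_eq [Nonempty A] {t : SearchTree A Z} {L m : ℕ} {g : History A Z}
    {τ : List (Visit X A Z)} (hτ : M.IsTrace sel R t m g τ) (hL : m + g.length = L)
    {h : History A Z} (hlt : g.length ≤ h.length) (a : A) {U : Finset Z}
    (hU : (M.obsDist (M.belief h) a).support ⊆ U) :
    M.armDev L h a τ = armSum a (fun x z _ => M.targetDev L h a x z) (atNode h τ) +
      M.discount * ∑ z ∈ U, M.nodeDev L ((a, z) :: h) τ := by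
  classical
  induction hτ with
  | leaf g =>
    have hn : ∀ h : History A Z, atNode h ([] : List (Visit X A Z)) = [] := fun h => rfl
    rw [armDev_eq_zero L a (hn h), Finset.sum_eq_zero fun z _ => nodeDev_eq_zero L (hn _), hn h,
      armSum_nil]
    simp
  | expand m g r ht hr =>
    have hn : ∀ z, atNode ((a, z) :: h) [((g, none, r) : Visit X A Z)] = [] := fun z => by
      rw [atNode_cons_ne]
      · rfl
      · rintro rfl
        simp at hlt
    rw [Finset.sum_eq_zero fun z _ => nodeDev_eq_zero L (hn z)]
    by_cases hg : g = h
    · subst hg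
      rw [armDev, atNode_cons_self]
      simp [atNode, armRet, pulls, armSum_none]
    · have : atNode h [((g, none, r) : Visit X A Z)] = [] := by rw [atNode_cons_ne hg]; rfl
      rw [armDev_eq_zero L a this, this, armSum_nil]
      simp
  | step m g s x a₀ z₀ τ ht ha hz hτ ih =>
    have hne : ∀ z, g ≠ (a, z) :: h := by
      rintro z rfl
      simp at hlt
    have hch : ∀ z, M.nodeDev L ((a, z) :: h)
        ((g, some (x, a₀, z₀), M.reward x a₀ + M.discount * traceReturn τ) :: τ) =
        M.nodeDev L ((a, z) :: h) τ := fun z => by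
      simp only [nodeDev, atNode_cons_ne (hne z)]
    simp only [hch]
    have hL' : m + ((a₀, z₀) :: g).length = L := by simp; omega
    rcases hlt.lt_or_eq with hlt | hlen
    · have hg : g ≠ h := by rintro rfl; exact hlt.false
      simp only [armDev, atNode_cons_ne hg] at ih ⊢
      exact ih hL' (by simpa using hlt)
    · have hnil : atNode h τ = [] := hτ.atNode_eq_nil (by simp; omega) (by
        rintro rfl
        simp at hlen)
      have hoff : ∀ z, (a, z) :: h ≠ (a₀, z₀) :: g → M.nodeDev L ((a, z) :: h) τ = 0 :=
        fun z hz => nodeDev_eq_zero L (hτ.atNode_eq_nil (by simp; omega) hz)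
      by_cases hg : g = h
      · subst hg
        rw [armDev, atNode_cons_self, hnil, armRet, pulls, armSum_some, armSum_some, armSum_some]
        by_cases haa : a₀ = a
        · subst haa
          -- Only the child of the observed `z₀` is visited, and R - Q^* = (r + γV^* - Q^*) + γ(R' -
          -- V^*) with R' the return of that child.
          rw [Finset.sum_eq_single_of_mem z₀ (hU hz) fun z _ hzz => hoff z (by simpa using hzz),
            hτ.nodeDev_start hL']
          simp only [if_true, targetDev, List.length_cons, Nat.sub_sub]
          push_cast
          ring
        · rw [Finset.sum_eq_zero fun z _ => hoff z (by simp [Ne.symm haa])]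
          simp [haa]
      · rw [Finset.sum_eq_zero fun z _ => hoff z (by simp [Ne.symm hg])]
        have : atNode h ((g, some (x, a₀, z₀), M.reward x a₀ + M.discount * traceReturn τ) :: τ)
            = [] := by rw [atNode_cons_ne hg, hnil]
        rw [armDev_eq_zero L a this, this, armSum_nil]
        simp

theorem IsLog.armDev_eq [Nonempty A] {L : ℕ} {ω : List (List (Visit X A Z))}
    (hω : IsLog M sel R L ω) (h : History A Z) (a : A) {U : Finset Z}
    (hU : (M.obsDist (M.belief h) a).support ⊆ U) :
    M.armDev L h a ω.flatten =
      armSum a (fun x z _ => M.targetDev L h a x z) (atNode h ω.flatten) +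
        M.discount * ∑ z ∈ U, M.nodeDev L ((a, z) :: h) ω.flatten := by
  induction hω with
  | nil =>
    have hn : ∀ h : History A Z, atNode h ([] : List (Visit X A Z)) = [] := fun h => rfl
    rw [List.flatten_nil, armDev_eq_zero L a (hn h),
      Finset.sum_eq_zero fun z _ => nodeDev_eq_zero L (hn _), hn h, armSum_nil]
    simp
  | cons τ ω hω hτ ih =>
    simp only [List.flatten_cons, armDev_append, nodeDev_append, atNode_append, armSum_append,
      Finset.sum_add_distrib]
    rw [ih, hτ.armDev_eq (by simp) (by simp) a hU]
    ring

/-- A child of `h` by action `a` is visited at most as often as `a` is chosen at `h`. -/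
theorem IsTrace.length_child_le {t : SearchTree A Z} {m : ℕ} {g : History A Z}
    {τ : List (Visit X A Z)} (hτ : M.IsTrace sel R t m g τ)
    {h : History A Z} (hlt : g.length ≤ h.length) (a : A) (z : Z) :
    (atNode ((a, z) :: h) τ).length ≤ pulls a (atNode h τ) := by
  classical
  induction hτ with
  | leaf g => simp [atNode]
  | expand m g r ht hr =>
    rw [atNode_cons_ne]
    · simp [atNode]
    · rintro rfl
      simp at hlt
  | step m g s x a₀ z₀ τ ht ha hz hτ ih =>
    rw [atNode_cons_ne (by rintro rfl; simp at hlt)]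
    rcases hlt.lt_or_eq with hlt | hlen
    · rw [atNode_cons_ne (by rintro rfl; exact hlt.false)]
      exact ih (by simpa using hlt)
    · by_cases he : (a, z) :: h = (a₀, z₀) :: g
      · simp only [List.cons.injEq, Prod.mk.injEq] at he
        obtain ⟨⟨rfl, rfl⟩, rfl⟩ := he
        obtain ⟨-, h2, h3⟩ := hτ.retSum_atNode_start
        rw [atNode_cons_self, hτ.atNode_eq_nil (h := h) (by simp) (by simp), pulls, armSum_some]
        rcases Nat.eq_zero_or_pos m with hm | hm
        · simp [h3 hm]
        · simp [h2 hm]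
      · rw [hτ.atNode_eq_nil (by simp; omega) he]
        simp

theorem IsLog.length_child_le {L : ℕ} {ω : List (List (Visit X A Z))}
    (hω : IsLog M sel R L ω) (h : History A Z) (a : A) (z : Z) :
    (atNode ((a, z) :: h) ω.flatten).length ≤ pulls a (atNode h ω.flatten) := by
  induction hω with
  | nil => simp [atNode]
  | cons τ ω hω hτ ih =>
    simp only [List.flatten_cons, atNode_append, List.length_append, pulls, armSum_append]
    exact add_le_add (hτ.length_child_le (by simp) a z) ih

/-- Calls at the horizon return without leaving a record. This is the base case of the backward
induction. -/
theorem IsLog.atNode_leaf {L : ℕ} {ω : List (List (Visit X A Z))} (hω : IsLog M sel R L ω)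
    {h : History A Z} (hL : L ≤ h.length) : atNode h ω.flatten = [] := by
  have aux : ∀ {t : SearchTree A Z} {m : ℕ} {g : History A Z} {τ : List (Visit X A Z)},
      M.IsTrace sel R t m g τ → m + g.length ≤ h.length → atNode h τ = [] := by
    intro t m g τ hτ
    induction hτ with
    | leaf g => intro _; rfl
    | expand m g r ht hr =>
      intro hm
      rw [atNode_cons_ne (by rintro rfl; omega)]
      rfl
    | step m g s x a₀ z₀ τ ht ha hz hτ ih =>
      intro hm
      rw [atNode_cons_ne (by rintro rfl; omega)]
      exact ih (by simp; omega)
  induction hω with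
  | nil => rfl
  | cons τ ω hω hτ ih =>
    rw [List.flatten_cons, atNode_append, ih, aux hτ (by simpa using hL)]
    rfl

theorem IsLog.root_stats {L : ℕ} {ω : List (List (Visit X A Z))} (hω : IsLog M sel R L ω)
    (hL : 0 < L) : (atNode [] ω.flatten).length = ω.length ∧
      retSum (atNode [] ω.flatten) = (ω.map traceReturn).sum := by
  induction hω with
  | nil => simp [atNode, retSum]
  | cons τ ω hω hτ ih =>
    obtain ⟨h1, h2, -⟩ := hτ.retSum_atNode_start
    simp only [List.flatten_cons, atNode_append, List.length_append, retSum_append, ih, h1, h2 hL,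
      List.length_cons, List.map_cons, List.sum_cons]
    exact ⟨add_comm _ _, trivial⟩

end POMDP

namespace PMF

variable {α β : Type*}

theorem expect_comm (p : PMF α) (q : PMF β) (f : α → β → ℝ≥0∞) :
    (p.expect fun a => q.expect fun b => f a b) = q.expect fun b => p.expect fun a => f a b := by
  unfold expect
  simp_rw [← ENNReal.tsum_mul_left]
  rw [ENNReal.tsum_comm]
  exact tsum_congr fun b => tsum_congr fun a => by ring

theorem expect_le_of_le_support (p : PMF α) {f : α → ℝ≥0∞} {c : ℝ≥0∞}
    (h : ∀ a ∈ p.support, f a ≤ c) : p.expect f ≤ c := by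
  refine le_trans (ENNReal.tsum_le_tsum fun a => ?_) (p.expect_const c).le
  by_cases ha : a ∈ p.support
  · gcongr
    exact h a ha
  · rw [(PMF.apply_eq_zero_iff p a).2 ha]
    simp

end PMF

/-! ### Exponential supermartingale of an arm -/

namespace POMDP

variable {X A Z : Type*} {M : POMDP X A Z} {ρ : History A Z → PMF A}
  {sel : SearchTree A Z → History A Z → PMF A} {R : ℝ}

/-- The descent argument of `IsTrace.atNode_eq_nil` for an arbitrary hidden state: inside an
expectation `x` is not known to lie in the support of the belief. -/
theorem atNode_eq_nil_of_mem_support {t : SearchTree A Z} {h : History A Z} (m : ℕ) (x : X)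
    (g : History A Z) (hlt : h.length < g.length) :
    ∀ τ ∈ (M.simTrace ρ sel m x g t).support, atNode h τ = [] := by
  have hne : g ≠ h := by rintro rfl; exact hlt.false
  induction m generalizing x g with
  | zero =>
    intro τ hτ
    simp only [simTrace, PMF.support_pure, Set.mem_singleton_iff] at hτ
    subst hτ
    rfl
  | succ m ih =>
    intro τ hτ
    rw [simTrace] at hτ
    split at hτ
    · obtain ⟨r, hr, rfl⟩ := (PMF.mem_support_map_iff _ _ _).1 hτ
      rw [atNode_cons_ne hne]
      rfl
    · simp only [PMF.mem_support_bind_iff, PMF.mem_support_map_iff] at hτ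
      obtain ⟨a, ha, x', hx', z, hz, τ', hτ', rfl⟩ := hτ
      rw [atNode_cons_ne hne]
      have hlt' : h.length < ((a, z) :: g).length := by simp; omega
      exact ih x' _ hlt' (by rintro rfl; exact hlt'.false) τ' hτ'

variable (M) in
/-- Exponential weight of the one-step deviations of action `a` at node `h`. -/
noncomputable def armWeight (L : ℕ) (h : History A Z) (a : A) (c l : ℝ)
    (τ : List (Visit X A Z)) : ℝ :=
  Real.exp (l * armSum a (fun x z _ => M.targetDev L h a x z) (atNode h τ) -
    c ^ 2 * l ^ 2 / 2 * pulls a (atNode h τ))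

theorem armWeight_append (L : ℕ) (h : History A Z) (a : A) (c l : ℝ)
    (τ τ' : List (Visit X A Z)) :
    M.armWeight L h a c l (τ ++ τ') = M.armWeight L h a c l τ * M.armWeight L h a c l τ' := by
  simp only [armWeight, atNode_append, pulls, armSum_append, ← Real.exp_add]
  push_cast
  ring_nf

theorem armWeight_eq_one (L : ℕ) {h : History A Z} (a : A) (c l : ℝ) {τ : List (Visit X A Z)}
    (hn : atNode h τ = []) : M.armWeight L h a c l τ = 1 := by
  simp [armWeight, hn, pulls, armSum_nil]

/-- State and observation are dependent, but the deviation is a sum of a function of each, so its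
mean involves only the marginals `belief` and `obsDist`. These define Q^*, hence the mean is zero
and Hoeffding's lemma applies. -/
theorem expect_exp_targetDev_le [Nonempty A] (hR : ∀ x a, |M.reward x a| ≤ R) {L : ℕ}
    {h : History A Z} {a : A} {c : ℝ} (hc : ∀ x z, |M.targetDev L h a x z| ≤ c) (l : ℝ) :
    ((M.belief h).expect fun x => (M.trans x a).expect fun x' => (M.obs x').expect fun z =>
      ENNReal.ofReal (Real.exp (l * M.targetDev L h a x z))) ≤
      ENNReal.ofReal (Real.exp (c ^ 2 * l ^ 2 / 2)) := by
  set q : PMF (X × Z) := (M.belief h).bind fun x => (M.trans x a).bind fun x' =>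
    (M.obs x').map fun z => (x, z) with hq
  have hfst : q.map Prod.fst = M.belief h := by
    have hconst : ∀ (x : X) (x' : X), ((M.obs x').map fun _ : Z => x) = PMF.pure x :=
      fun x x' => PMF.map_const _ _
    simp only [hq, PMF.map_bind, PMF.map_comp, Function.comp_def, hconst, PMF.bind_const,
      PMF.bind_pure]
  have hsnd : q.map Prod.snd = M.obsDist (M.belief h) a := by
    simp only [hq, PMF.map_bind, PMF.map_comp, Function.comp_def, obsDist, predict,
      PMF.bind_bind]
    congr! 4
    exact PMF.map_id _
  have hV := fun z : Z => abs_optValue_le hR (L - h.length - 1) ((a, z) :: h)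
  have h1 := q.tsum_map_toReal_mul Prod.fst (f := fun x => M.reward x a) fun x => hR x a
  have h2 := q.tsum_map_toReal_mul Prod.snd hV
  have s1 := q.summable_toReal_mul (f := fun w => M.reward w.1 a) fun w => hR w.1 a
  have s2 := q.summable_toReal_mul fun w => hV w.2
  rw [hfst] at h1
  rw [hsnd] at h2
  have hmean : ∑' w, (q w).toReal * M.targetDev L h a w.1 w.2 = 0 := by
    have hsplit : ∀ w, (q w).toReal * M.targetDev L h a w.1 w.2 =
        (q w).toReal * M.reward w.1 a +
        M.discount * ((q w).toReal * M.optValue (L - h.length - 1) ((a, w.2) :: h)) -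
        (q w).toReal * M.optQ (L - h.length - 1) h a := fun w => by
      rw [targetDev]
      ring
    rw [tsum_congr hsplit, (s1.add (s2.mul_left _)).tsum_sub (q.summable_toReal.mul_right _),
      s1.tsum_add (s2.mul_left _), tsum_mul_left, tsum_mul_right, q.tsum_toReal, ← h1, ← h2,
      optQ, beliefReward]
    ring
  have := q.expect_exp_le (fun w => hc w.1 w.2) hmean l
  simpa only [hq, PMF.expect_bind, PMF.expect_map] using this

/-- Averaging the hidden state over the belief is preserved when the simulation descends
(`expect_trans_obs`). At the node `h` the compensator of the weight cancels the Hoeffding bound;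
elsewhere the weight does not change. -/
theorem expect_armWeight_le_one [Nonempty A] (hR : ∀ x a, |M.reward x a| ≤ R) {L : ℕ}
    {h : History A Z} {a : A} {c : ℝ} (hc : ∀ x z, |M.targetDev L h a x z| ≤ c) (l : ℝ)
    (t : SearchTree A Z) (m : ℕ) (g : History A Z) :
    ((M.belief g).expect fun x => (M.simTrace ρ sel m x g t).expect fun τ =>
      ENNReal.ofReal (M.armWeight L h a c l τ)) ≤ 1 := by
  classical
  induction m generalizing g with
  | zero =>
    refine PMF.expect_le_of_le _ fun x => ?_
    rw [simTrace, PMF.expect_pure, armWeight_eq_one L a c l rfl, ENNReal.ofReal_one]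
  | succ m ih =>
    simp only [simTrace]
    cases ht : t g with
    | none =>
      refine PMF.expect_le_of_le _ fun x => ?_
      rw [PMF.expect_map]
      refine PMF.expect_le_of_le _ fun r => ?_
      refine (ENNReal.ofReal_le_one.2 (le_of_eq ?_))
      by_cases hg : g = h
      · subst hg
        rw [armWeight, atNode_cons_self]
        simp [atNode, pulls, armSum_none]
      · refine armWeight_eq_one L a c l ?_
        rw [atNode_cons_ne hg]
        rfl
    | some s =>
      simp only [PMF.expect_bind, PMF.expect_map]
      -- The action depends on the tree and not on the hidden state, so it may be drawn first.
      rw [PMF.expect_comm]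
      refine PMF.expect_le_of_le _ fun a' => ?_
      by_cases hga : g = h ∧ a' = a
      · obtain ⟨rfl, rfl⟩ := hga
        calc _ ≤ (M.belief g).expect fun x => (M.trans x a').expect fun x' =>
              (M.obs x').expect fun z => ENNReal.ofReal (Real.exp (-(c ^ 2 * l ^ 2 / 2))) *
                ENNReal.ofReal (Real.exp (l * M.targetDev L g a' x z)) := by
              refine PMF.expect_mono _ fun x => PMF.expect_mono _ fun x' =>
                PMF.expect_mono _ fun z => PMF.expect_le_of_le_support _ fun τ hτ => ?_
              rw [← ENNReal.ofReal_mul (Real.exp_nonneg _), ← Real.exp_add, armWeight,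
                atNode_cons_self, atNode_eq_nil_of_mem_support m x' _ (by simp) τ hτ, pulls,
                armSum_some, armSum_some]
              apply le_of_eq
              congr 2
              simp
              ring
          _ = ENNReal.ofReal (Real.exp (-(c ^ 2 * l ^ 2 / 2))) *
              (M.belief g).expect fun x => (M.trans x a').expect fun x' =>
              (M.obs x').expect fun z =>
                ENNReal.ofReal (Real.exp (l * M.targetDev L g a' x z)) := by
              simp only [PMF.expect_const_mul]
          _ ≤ ENNReal.ofReal (Real.exp (-(c ^ 2 * l ^ 2 / 2))) *
              ENNReal.ofReal (Real.exp (c ^ 2 * l ^ 2 / 2)) := by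
              gcongr
              exact expect_exp_targetDev_le hR hc l
          _ = 1 := by
              rw [← ENNReal.ofReal_mul (Real.exp_nonneg _), ← Real.exp_add]
              simp
      · have hw : ∀ x z r (τ : List (Visit X A Z)),
            M.armWeight L h a c l ((g, some (x, a', z), r) :: τ) = M.armWeight L h a c l τ := by
          intro x z r τ
          by_cases hg : g = h
          · subst hg
            have ha : a' ≠ a := fun he => hga ⟨rfl, he⟩
            rw [← List.singleton_append, armWeight_append, armWeight, atNode_cons_self]
            simp [atNode, pulls, armSum_some, ha]
          · simp only [armWeight, atNode_cons_ne hg]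
        simp only [hw]
        rw [expect_trans_obs]
        exact PMF.expect_le_of_le _ fun z => ih ((a', z) :: g)

/-- Ville's inequality. The function `G` is the weight divided by `K`, replaced by 1 once level `K`
has been reached; its expectation does not increase with `n` and starts at no more than 1/K. -/
theorem toOuterMeasure_exists_armWeight_ge [Nonempty A] (hR : ∀ x a, |M.reward x a| ≤ R) {L : ℕ}
    {h : History A Z} {a : A} {c : ℝ} (hc : ∀ x z, |M.targetDev L h a x z| ≤ c) (l : ℝ)
    {K : ℝ} (hK : 0 < K) (n : ℕ) :
    (M.searchLog ρ sel L n).toOuterMeasure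
      {ω | ∃ ω', ω' <:+ ω ∧ K ≤ M.armWeight L h a c l ω'.flatten} ≤ ENNReal.ofReal (1 / K) := by
  classical
  set hit : List (List (Visit X A Z)) → Prop :=
    fun ω => ∃ ω', ω' <:+ ω ∧ K ≤ M.armWeight L h a c l ω'.flatten with hhit
  set G : List (List (Visit X A Z)) → ℝ≥0∞ := fun ω => if hit ω then 1 else
    ENNReal.ofReal (M.armWeight L h a c l ω.flatten) * ENNReal.ofReal (1 / K) with hG
  have hpos : ∀ τ : List (Visit X A Z), 0 ≤ M.armWeight L h a c l τ :=
    fun τ => Real.exp_nonneg _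
  have hone : ∀ {w : ℝ}, K ≤ w → 1 ≤ ENNReal.ofReal w * ENNReal.ofReal (1 / K) := by
    intro w hw
    rw [← ENNReal.ofReal_mul (hK.le.trans hw), ENNReal.one_le_ofReal, mul_one_div,
      one_le_div hK]
    exact hw
  refine (PMF.toOuterMeasure_le_expect _ _ (f := G) fun ω hω => ?_).trans ?_
  · have : hit ω := hω
    simp [hG, this]
  · induction n with
    | zero =>
      rw [searchLog, PMF.expect_pure]
      have h1 : M.armWeight L h a c l ([] : List (List (Visit X A Z))).flatten = 1 :=
        armWeight_eq_one L a c l rfl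
      simp only [hG]
      split_ifs with h0
      · obtain ⟨ω', hs, hk⟩ := h0
        rw [List.suffix_nil.1 hs, h1] at hk
        simpa using hone hk
      · rw [h1]
        simp
    | succ n ih =>
      refine le_trans ?_ ih
      rw [searchLog, PMF.expect_bind]
      refine PMF.expect_mono _ fun ω => ?_
      simp only [PMF.expect_bind, PMF.expect_map]
      by_cases hω : hit ω
      · refine (PMF.expect_le_of_le _ fun x => PMF.expect_le_of_le _ fun τ => ?_ :
          _ ≤ (1 : ℝ≥0∞)).trans (by simp [hG, hω])
        obtain ⟨ω', hs, hk⟩ := hω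
        have : hit (τ :: ω) := ⟨ω', hs.trans (List.suffix_cons _ _), hk⟩
        simp [hG, this]
      · have hle : ∀ τ, G (τ :: ω) ≤ (ENNReal.ofReal (M.armWeight L h a c l ω.flatten) *
            ENNReal.ofReal (1 / K)) * ENNReal.ofReal (M.armWeight L h a c l τ) := by
          intro τ
          have heq : (ENNReal.ofReal (M.armWeight L h a c l ω.flatten) *
              ENNReal.ofReal (1 / K)) * ENNReal.ofReal (M.armWeight L h a c l τ) =
              ENNReal.ofReal (M.armWeight L h a c l (τ :: ω).flatten) *
                ENNReal.ofReal (1 / K) := by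
            rw [List.flatten_cons, armWeight_append, ENNReal.ofReal_mul (hpos _)]
            ring
          rw [heq]
          simp only [hG]
          split_ifs with h0
          · obtain ⟨ω', hs, hk⟩ := h0
            rcases List.suffix_cons_iff.1 hs with rfl | hs
            · exact hone hk
            · exact (hω ⟨ω', hs, hk⟩).elim
          · exact le_rfl
        have hGω : G ω = ENNReal.ofReal (M.armWeight L h a c l ω.flatten) *
            ENNReal.ofReal (1 / K) := by simp [hG, hω]
        calc _ ≤ M.init.expect fun x => (M.simTrace ρ sel L x [] (treeOf ω)).expect fun τ =>
              G ω * ENNReal.ofReal (M.armWeight L h a c l τ) :=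
              PMF.expect_mono _ fun x => PMF.expect_mono _ fun τ => by
                rw [hGω]; exact hle τ
          _ = G ω * M.init.expect fun x => (M.simTrace ρ sel L x [] (treeOf ω)).expect fun τ =>
              ENNReal.ofReal (M.armWeight L h a c l τ) := by
              simp only [PMF.expect_const_mul]
          _ ≤ G ω * 1 := by
              gcongr
              exact expect_armWeight_le_one hR hc l (treeOf ω) L []
          _ = G ω := mul_one _

/-- Maximal Azuma inequality for the one-step deviations of an arm. -/
theorem toOuterMeasure_exists_armSum_ge [Nonempty A] (hR : ∀ x a, |M.reward x a| ≤ R) {L : ℕ}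
    {h : History A Z} {a : A} {c : ℝ} (hc0 : 0 < c) (hc : ∀ x z, |M.targetDev L h a x z| ≤ c)
    {N : ℕ} (hN : 1 ≤ N) {ε : ℝ} (hε : 0 < ε) (n : ℕ) :
    (M.searchLog ρ sel L n).toOuterMeasure
      {ω | ∃ ω', ω' <:+ ω ∧ pulls a (atNode h ω'.flatten) ≤ N ∧
        ε ≤ |armSum a (fun x z _ => M.targetDev L h a x z) (atNode h ω'.flatten)|} ≤
      ENNReal.ofReal (2 * Real.exp (-(ε ^ 2 / (2 * N * c ^ 2)))) := by
  have hN0 : (0 : ℝ) < N := by exact_mod_cast hN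
  -- This `l` maximizes l ε - c² l² N / 2. Fewer than `N` pulls only make the compensator smaller.
  set l : ℝ := ε / (N * c ^ 2) with hl
  have hl0 : 0 < l := by positivity
  set K : ℝ := Real.exp (ε ^ 2 / (2 * N * c ^ 2)) with hK
  have key : ∀ (s : ℝ) (T : ℕ), T ≤ N → ε ≤ s →
      ε ^ 2 / (2 * N * c ^ 2) ≤ l * s - c ^ 2 * l ^ 2 / 2 * T := by
    intro s T hT hs
    have hT' : (T : ℝ) ≤ N := by exact_mod_cast hT
    have h1 : l * ε - c ^ 2 * l ^ 2 / 2 * N = ε ^ 2 / (2 * N * c ^ 2) := by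
      rw [hl]
      field_simp
      ring
    have h2 : l * ε ≤ l * s := mul_le_mul_of_nonneg_left hs hl0.le
    have h3 : c ^ 2 * l ^ 2 / 2 * T ≤ c ^ 2 * l ^ 2 / 2 * N :=
      mul_le_mul_of_nonneg_left hT' (by positivity)
    linarith
  have hsub : {ω : List (List (Visit X A Z)) | ∃ ω', ω' <:+ ω ∧
        pulls a (atNode h ω'.flatten) ≤ N ∧
        ε ≤ |armSum a (fun x z _ => M.targetDev L h a x z) (atNode h ω'.flatten)|} ⊆
      {ω | ∃ ω', ω' <:+ ω ∧ K ≤ M.armWeight L h a c l ω'.flatten} ∪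
      {ω | ∃ ω', ω' <:+ ω ∧ K ≤ M.armWeight L h a c (-l) ω'.flatten} := by
    rintro ω ⟨ω', hs, hT, hab⟩
    rcases le_abs.1 hab with hab | hab
    · exact Or.inl ⟨ω', hs, Real.exp_le_exp.2 (key _ _ hT hab)⟩
    · refine Or.inr ⟨ω', hs, Real.exp_le_exp.2 ((key _ _ hT hab).trans (le_of_eq ?_))⟩
      ring
  have hb := fun l => toOuterMeasure_exists_armWeight_ge (ρ := ρ) (sel := sel) hR hc l
    (Real.exp_pos _ : 0 < K) n
  refine ((MeasureTheory.measure_mono hsub).trans (MeasureTheory.measure_union_le _ _)).trans ?_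
  refine (add_le_add (hb l) (hb (-l))).trans (le_of_eq ?_)
  rw [← ENNReal.ofReal_add (by positivity) (by positivity), Real.exp_neg]
  congr 1
  ring

end POMDP

/-! ### A bandit with polynomially concentrated arms -/

theorem PMF.toOuterMeasure_biUnion_le {Ω ι : Type*} (p : PMF Ω) (I : Finset ι) (F : ι → Set Ω)
    (g : ι → ℝ) (hg : ∀ i ∈ I, 0 ≤ g i)
    (hF : ∀ i ∈ I, p.toOuterMeasure (F i) ≤ ENNReal.ofReal (g i)) :
    p.toOuterMeasure (⋃ i ∈ I, F i) ≤ ENNReal.ofReal (∑ i ∈ I, g i) := by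
  rw [ENNReal.ofReal_sum_of_nonneg hg]
  exact (MeasureTheory.measure_biUnion_finset_le _ _).trans (Finset.sum_le_sum hF)

theorem exists_exp_neg_sq_le (q ξ : ℝ) (hq : 0 < q) :
    ∃ C : ℝ, 0 ≤ C ∧ ∀ y : ℝ, 1 ≤ y → Real.exp (-(q * y ^ 2)) ≤ C * y ^ (-ξ) := by
  set n := ⌈ξ⌉₊
  refine ⟨n.factorial / q ^ n, by positivity, fun y hy => ?_⟩
  have hy0 : 0 < y := by linarith
  have h1 := Real.pow_div_factorial_le_exp (q * y ^ 2) (by positivity) n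
  have h2 : y ^ ξ ≤ (y ^ 2) ^ n := by
    rw [← pow_mul, ← Real.rpow_natCast]
    refine Real.rpow_le_rpow_of_exponent_le hy ?_
    push_cast
    have := Nat.le_ceil ξ
    have h0 : (0 : ℝ) ≤ n := Nat.cast_nonneg n
    linarith
  rw [Real.exp_neg, Real.rpow_neg hy0.le, ← div_eq_mul_inv, div_div,
    inv_le_comm₀ (Real.exp_pos _) (by positivity), inv_div]
  refine le_trans ?_ h1
  rw [mul_pow]
  gcongr

/-- The terms with s ≤ u give u · u^(-α). For s > u, α ≥ 2 allows s^(-α) ≤ u^(2-α) s^(-2), and the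
inverse squares sum to at most 1/u. -/
theorem sum_max_rpow_neg_le {α : ℝ} (hα : 2 ≤ α) {u : ℕ} (hu : 1 ≤ u) (N : ℕ) :
    ∑ s ∈ Finset.Icc 1 N, ((max u s : ℕ) : ℝ) ^ (-α) ≤ 2 * (u : ℝ) ^ (1 - α) := by
  have hu0 : (0 : ℝ) < u := by exact_mod_cast hu
  have hsub : Finset.Icc 1 N ⊆ Finset.Icc 1 u ∪ Finset.Ioc u (max u N) := by
    intro s hs
    simp only [Finset.mem_union, Finset.mem_Icc, Finset.mem_Ioc] at hs ⊢
    omega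
  have hdis : Disjoint (Finset.Icc 1 u) (Finset.Ioc u (max u N)) := by
    rw [Finset.disjoint_left]
    intro s hs
    simp only [Finset.mem_Icc, Finset.mem_Ioc] at hs ⊢
    omega
  refine (Finset.sum_le_sum_of_subset_of_nonneg hsub fun s _ _ => by positivity).trans ?_
  rw [Finset.sum_union hdis, two_mul]
  refine add_le_add (le_of_eq ?_) ?_
  · rw [Finset.sum_congr rfl fun s hs => by rw [max_eq_left (Finset.mem_Icc.1 hs).2]]
    rw [Finset.sum_const, Nat.card_Icc, Nat.add_sub_cancel, nsmul_eq_mul, sub_eq_add_neg,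
      Real.rpow_add hu0, Real.rpow_one]
  · calc ∑ s ∈ Finset.Ioc u (max u N), ((max u s : ℕ) : ℝ) ^ (-α)
        ≤ ∑ s ∈ Finset.Ioc u (max u N), (u : ℝ) ^ (2 - α) * ((s : ℝ) ^ 2)⁻¹ := by
          refine Finset.sum_le_sum fun s hs => ?_
          have hus : u ≤ s := (Finset.mem_Ioc.1 hs).1.le
          have hs0 : (0 : ℝ) < s := hu0.trans_le (by exact_mod_cast hus)
          rw [max_eq_right hus, show -α = (2 - α) + (-2 : ℝ) by ring, Real.rpow_add hs0,
            Real.rpow_neg hs0.le, Real.rpow_two]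
          refine mul_le_mul_of_nonneg_right ?_ (by positivity)
          exact Real.rpow_le_rpow_of_nonpos hu0 (by exact_mod_cast hus) (by linarith)
      _ ≤ (u : ℝ) ^ (2 - α) * (u : ℝ)⁻¹ := by
          rw [← Finset.mul_sum]
          refine mul_le_mul_of_nonneg_left ?_ (by positivity)
          refine (sum_Ioc_inv_sq_le_sub (by omega) (le_max_left u N)).trans ?_
          exact sub_le_self _ (by positivity)
      _ = (u : ℝ) ^ (1 - α) := by
          rw [← Real.rpow_neg_one, ← Real.rpow_add hu0]
          ring_nf

/-- If the estimates of a suboptimal action, chosen `u` times, and of an optimal one, chosen `s`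
times, are accurate, then the former does not have the larger index. -/
theorem ucbIndex_lt_of_accurate {β ξ η α Δ V μ Sa Sb : ℝ} (hβ : 0 < β) (hξ : 0 < ξ) (hα : 0 < α)
    (hη : η < 1) (hΔ : 0 < Δ) (hgap : μ + Δ ≤ V) {u s n N : ℕ} (hu : 1 ≤ u) (hs : 1 ≤ s)
    (hun : max u s ≤ n) (hnN : n ≤ N)
    (huN : (4 * β ^ (1 / ξ) / Δ) ^ (1 / (1 - η)) * (N : ℝ) ^ (α / (ξ * (1 - η))) ≤ u)
    (ha : |Sa - u * μ| < (u : ℝ) ^ η * ((u : ℝ) ^ (1 - η) * (Δ / 4)))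
    (hb : |Sb - s * V| < (s : ℝ) ^ η * (β ^ (1 / ξ) * ((max u s : ℕ) : ℝ) ^ (α / ξ))) :
    Sa / u + β ^ (1 / ξ) * (n : ℝ) ^ (α / ξ) * (u : ℝ) ^ (-(1 - η)) <
      Sb / s + β ^ (1 / ξ) * (n : ℝ) ^ (α / ξ) * (s : ℝ) ^ (-(1 - η)) := by
  have hu0 : (0 : ℝ) < u := by exact_mod_cast hu
  have hs0 : (0 : ℝ) < s := by exact_mod_cast hs
  have hb0 : 0 < β ^ (1 / ξ) := by positivity
  have h1η : 0 < 1 - η := by linarith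
  have hN0 : (0 : ℝ) ≤ N := Nat.cast_nonneg N
  have hmn : ((max u s : ℕ) : ℝ) ^ (α / ξ) ≤ (n : ℝ) ^ (α / ξ) :=
    Real.rpow_le_rpow (by positivity) (by exact_mod_cast hun) (by positivity)
  have hnN' : (n : ℝ) ^ (α / ξ) ≤ (N : ℝ) ^ (α / ξ) :=
    Real.rpow_le_rpow (by positivity) (by exact_mod_cast hnN) (by positivity)
  have hA : Sa / u < μ + Δ / 4 := by
    rw [← mul_assoc, ← Real.rpow_add hu0, add_sub_cancel, Real.rpow_one] at ha
    rw [div_lt_iff₀ hu0]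
    have := (abs_lt.1 ha).2
    linarith
  have hbonus : β ^ (1 / ξ) * (n : ℝ) ^ (α / ξ) * (u : ℝ) ^ (-(1 - η)) ≤ Δ / 4 := by
    have hpow : 4 * β ^ (1 / ξ) / Δ * (N : ℝ) ^ (α / ξ) ≤ (u : ℝ) ^ (1 - η) := by
      have := Real.rpow_le_rpow (by positivity) huN h1η.le
      rw [Real.mul_rpow (by positivity) (by positivity), ← Real.rpow_mul (by positivity),
        ← Real.rpow_mul hN0, one_div_mul_cancel h1η.ne', Real.rpow_one] at this
      rwa [show α / (ξ * (1 - η)) * (1 - η) = α / ξ by field_simp] at this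
    rw [Real.rpow_neg hu0.le, ← div_eq_mul_inv, div_le_iff₀ (by positivity)]
    calc β ^ (1 / ξ) * (n : ℝ) ^ (α / ξ) ≤ β ^ (1 / ξ) * (N : ℝ) ^ (α / ξ) := by gcongr
      _ = Δ / 4 * (4 * β ^ (1 / ξ) / Δ * (N : ℝ) ^ (α / ξ)) := by field_simp
      _ ≤ Δ / 4 * (u : ℝ) ^ (1 - η) := by gcongr
  -- The accuracy demanded in `hb` involves max(u,s) and not the current time `n`, so the union
  -- bound runs over `s` alone; the actual bonus is at least as large because max(u,s) ≤ n.
  have hB : V < Sb / s + β ^ (1 / ξ) * (n : ℝ) ^ (α / ξ) * (s : ℝ) ^ (-(1 - η)) := by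
    have h1 := (abs_lt.1 hb).1
    have h2 : (s : ℝ) ^ η * (β ^ (1 / ξ) * ((max u s : ℕ) : ℝ) ^ (α / ξ)) ≤
        s * (β ^ (1 / ξ) * (n : ℝ) ^ (α / ξ) * (s : ℝ) ^ (-(1 - η))) := by
      have hsη : (s : ℝ) ^ η = s * (s : ℝ) ^ (-(1 - η)) := by
        have := Real.rpow_add hs0 1 (-(1 - η))
        rw [Real.rpow_one] at this
        rw [← this]
        ring_nf
      rw [hsη]
      calc _ = s * (β ^ (1 / ξ) * ((max u s : ℕ) : ℝ) ^ (α / ξ) * (s : ℝ) ^ (-(1 - η))) := by ring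
        _ ≤ _ := by gcongr
    have h3 : s * V < Sb + s * (β ^ (1 / ξ) * (n : ℝ) ^ (α / ξ) * (s : ℝ) ^ (-(1 - η))) := by
      linarith
    have h4 : Sb = s * (Sb / s) := by field_simp
    rw [h4, ← mul_add] at h3
    exact lt_of_mul_lt_mul_left h3 hs0.le
  linarith

/-- A counter with increments at most 1 that ends above `u` steps from `u` to `u + 1` at some time.
It locates the pull of an arm at which its index is examined. -/
theorem exists_suffix_eq_of_lt {E : Type*} (f : List E → ℕ) (h0 : f [] = 0) (u : ℕ) (ω : List E)
    (hstep : ∀ τ ω', τ :: ω' <:+ ω → f (τ :: ω') ≤ f ω' + 1) (hu : u < f ω) :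
    ∃ τ ω', τ :: ω' <:+ ω ∧ f ω' = u ∧ f (τ :: ω') = u + 1 := by
  induction ω with
  | nil => omega
  | cons τ ω ih =>
    have h1 := hstep τ ω List.suffix_rfl
    by_cases hlt : u < f ω
    · obtain ⟨τ', ω', hs, h⟩ := ih (fun τ' ω' hs => hstep τ' ω' (hs.trans (List.suffix_cons _ _)))
        hlt
      exact ⟨τ', ω', hs.trans (List.suffix_cons _ _), h⟩
    · exact ⟨τ, ω, List.suffix_rfl, by omega, by omega⟩

theorem le_of_suffix {E : Type*} (f : List E → ℕ) (ω : List E)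
    (hstep : ∀ τ ω', τ :: ω' <:+ ω → f ω' ≤ f (τ :: ω')) {ω' : List E} (hs : ω' <:+ ω) :
    f ω' ≤ f ω := by
  induction ω with
  | nil => rw [List.suffix_nil.1 hs]
  | cons τ ω ih =>
    rcases List.suffix_cons_iff.1 hs with rfl | hs
    · exact le_rfl
    · exact (ih (fun τ' ω'' hs' => hstep τ' ω'' (hs'.trans (List.suffix_cons _ _))) hs).trans
        (hstep τ ω List.suffix_rfl)

set_option maxHeartbeats 1000000 in
/-- Polynomial concentration of the arms of a bandit with corrected UCB indices yields polynomial
concentration of the collected reward. The number of times an arm was chosen and its accumulated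
reward are functions `T a`, `S a` of the log of the process, most recent event first. -/
theorem exists_bandit_tail (k : ℕ) {B Δ β ξ η α C : ℝ} (hB : 0 ≤ B) (hΔ : 0 < Δ) (hβ : 1 < β)
    (hξ : 0 < ξ) (hη0 : 0 ≤ η) (hη : η < 1) (hα : 2 < α) (hlow : ξ * η * (1 - η) ≤ α)
    (hup : α < ξ * (1 - η)) (hC : 1 ≤ C) :
    ∃ C₀ : ℝ, 1 ≤ C₀ ∧ ∀ {E A : Type*} [Fintype A] (_ : Fintype.card A = k) (p : PMF (List E))
      (T : A → List E → ℕ) (S : A → List E → ℝ) (v : List E → ℕ) (D : List E → ℝ) (μ : A → ℝ)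
      (V : ℝ) (_ : ∃ a, μ a = V) (_ : ∀ a, μ a = V ∨ μ a + Δ ≤ V) (_ : ∀ a, T a [] = 0)
      (_ : ∀ ω ∈ p.support, ∀ τ ω', τ :: ω' <:+ ω → ∀ a, T a (τ :: ω') = T a ω' ∨
        (T a (τ :: ω') = T a ω' + 1 ∧ (T a ω' = 0 ∨ ((∀ b, T b ω' ≠ 0) ∧ ∀ b,
          S b ω' / T b ω' + β ^ (1 / ξ) * ((∑ i, T i ω' : ℕ) : ℝ) ^ (α / ξ) *
            (T b ω' : ℝ) ^ (-(1 - η)) ≤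
          S a ω' / T a ω' + β ^ (1 / ξ) * ((∑ i, T i ω' : ℕ) : ℝ) ^ (α / ξ) *
            (T a ω' : ℝ) ^ (-(1 - η))))))
      (_ : ∀ ω ∈ p.support, ∀ ω', ω' <:+ ω → (∀ a, |S a ω' - T a ω' * V| ≤ 2 * B * T a ω') ∧
        |D ω' - ∑ a, (S a ω' - T a ω' * V)| ≤ 2 * B ∧ ∑ a, T a ω' ≤ v ω')
      (_ : ∀ a (N : ℕ) (y : ℝ), 1 ≤ N → 0 < y → p.toOuterMeasure
        {ω | ∃ ω', ω' <:+ ω ∧ T a ω' ≤ N ∧ (N : ℝ) ^ η * y ≤ |S a ω' - T a ω' * μ a|} ≤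
          ENNReal.ofReal (C * y ^ (-ξ)))
      (N : ℕ) (y : ℝ) (_ : 1 ≤ N) (_ : 0 < y),
      p.toOuterMeasure
        {ω | ∃ ω', ω' <:+ ω ∧ v ω' ≤ N ∧ (N : ℝ) ^ (α / (ξ * (1 - η))) * y ≤ |D ω'|} ≤
          ENNReal.ofReal (C₀ * y ^ (-(α - 1))) := by
  have h1η : 0 < 1 - η := by linarith
  have hβ0 : 0 < β := by linarith
  have hηη : η ≤ α / (ξ * (1 - η)) := by
    rw [le_div_iff₀ (by positivity)]
    linarith
  have hξα : α ≤ ξ := hup.le.trans (mul_le_of_le_one_right hξ.le (by linarith))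
  set c₁ : ℝ := max 1 ((4 * β ^ (1 / ξ) / Δ) ^ (1 / (1 - η))) with hc₁
  have hc1 : 1 ≤ c₁ := le_max_left _ _
  -- On the good event the deviation is at most (G - 1) N^e y': 2B from the visit without a pull,
  -- and (1 + 4 B c₁) N^e y' from each of the `k` arms.
  set G : ℝ := 2 * B + k * (1 + 4 * B * c₁) + 1 with hG
  have hG1 : 1 ≤ G := by
    have : 0 ≤ 2 * B + k * (1 + 4 * B * c₁) := by positivity
    linarith
  have hG0 : 0 < G := by linarith
  set C₁ : ℝ := k * C + k * (C * (Δ / 4) ^ (-ξ)) + 2 * C with hC₁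
  have hC0 : 0 ≤ C := by linarith
  have hC10 : 0 ≤ C₁ := by positivity
  -- The power of `G` undoes the rescaling y' = y / G. The `+ 1` makes the claim trivial for y' < 1.
  refine ⟨(C₁ + 1) * G ^ (α - 1), one_le_mul_of_one_le_of_one_le (by linarith)
    (Real.one_le_rpow hG1 (by linarith)), ?_⟩
  intro E A _ hk p T S v D μ V ⟨a₀, ha₀⟩ hgap hT0 hstep hbd harm N y hN hy
  have hN0 : (0 : ℝ) < N := by exact_mod_cast hN
  have hN1 : (1 : ℝ) ≤ N := by exact_mod_cast hN
  set y' : ℝ := y / G with hy'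
  have hy'0 : 0 < y' := by positivity
  have hrw : (C₁ + 1) * G ^ (α - 1) * y ^ (-(α - 1)) = (C₁ + 1) * y' ^ (-(α - 1)) := by
    rw [hy', Real.div_rpow hy.le hG0.le, Real.rpow_neg hG0.le, div_inv_eq_mul]
    ring
  rw [hrw]
  rcases lt_or_ge y' 1 with hlt | hy1
  · refine (p.toOuterMeasure_le_one _).trans (ENNReal.one_le_ofReal.2 ?_)
    have := Real.one_le_rpow_of_pos_of_le_one_of_nonpos hy'0 hlt.le
      (by linarith : -(α - 1) ≤ 0)
    nlinarith
  set e : ℝ := α / (ξ * (1 - η)) with he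
  have he0 : 0 ≤ e := hη0.trans hηη
  have hNe : 1 ≤ (N : ℝ) ^ e := Real.one_le_rpow hN1 he0
  have hNy : 1 ≤ (N : ℝ) ^ e * y' := one_le_mul_of_one_le_of_one_le hNe hy1
  set u : ℕ := ⌈c₁ * (N : ℝ) ^ e * y'⌉₊ with hu
  have hu_le : c₁ * (N : ℝ) ^ e * y' ≤ u := Nat.le_ceil _
  have hcNy : 1 ≤ c₁ * (N : ℝ) ^ e * y' := by
    rw [mul_assoc]
    exact one_le_mul_of_one_le_of_one_le hc1 hNy
  have hu1' : (1 : ℝ) ≤ u := hcNy.trans hu_le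
  have hu1 : 1 ≤ u := by exact_mod_cast hu1'
  have hu_ge : (u : ℝ) ≤ 2 * c₁ * ((N : ℝ) ^ e * y') := by
    have := (Nat.ceil_lt_add_one (zero_le_one.trans hcNy)).le
    rw [← hu] at this
    linarith
  have hyu : y' ≤ u := by
    refine le_trans ?_ hu_le
    exact le_mul_of_one_le_left hy'0.le (one_le_mul_of_one_le_of_one_le hc1 hNe)
  have hu0 : (0 : ℝ) < u := by linarith
  have huN : (4 * β ^ (1 / ξ) / Δ) ^ (1 / (1 - η)) * (N : ℝ) ^ e ≤ u := by
    refine le_trans ?_ hu_le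
    refine le_trans ?_ (le_mul_of_one_le_right (by positivity) hy1)
    exact mul_le_mul_of_nonneg_right (le_max_right _ _) (by positivity)
  set bad : A → ℕ → ℝ → Set (List E) := fun a N y =>
    {ω | ∃ ω', ω' <:+ ω ∧ T a ω' ≤ N ∧ (N : ℝ) ^ η * y ≤ |S a ω' - T a ω' * μ a|} with hbad
  -- Bad events: an arm deviates on the scale N^η y'; an arm with at most `u` pulls has error u Δ/4;
  -- the optimal arm `a₀` errs by more than its bonus at some number `s` of pulls. Intersecting with
  -- the support gives access to the pathwise hypotheses.
  have hsub : {ω | ∃ ω', ω' <:+ ω ∧ v ω' ≤ N ∧ (N : ℝ) ^ e * y ≤ |D ω'|} ∩ p.support ⊆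
      (⋃ a ∈ (Finset.univ : Finset A), bad a N y') ∪
      (⋃ a ∈ (Finset.univ : Finset A), bad a u ((u : ℝ) ^ (1 - η) * (Δ / 4))) ∪
      ⋃ s ∈ Finset.Icc 1 N, bad a₀ s (β ^ (1 / ξ) * ((max u s : ℕ) : ℝ) ^ (α / ξ)) := by
    rintro ω ⟨⟨ω₁, hs₁, hv, hD⟩, hω⟩
    by_contra hnot
    simp only [Set.mem_union, Set.mem_iUnion, not_or, not_exists, Finset.mem_univ, true_implies,
      hbad, Set.mem_ofPred_eq, not_and, not_le, Finset.mem_Icc] at hnot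
    obtain ⟨⟨hn1, hn2⟩, hn3⟩ := hnot
    obtain ⟨hb1, hb2, hb3⟩ := hbd ω hω ω₁ hs₁
    have hTN : ∀ a, T a ω₁ ≤ N := fun a =>
      (Finset.single_le_sum (f := fun a => T a ω₁) (fun _ _ => Nat.zero_le _)
        (Finset.mem_univ a)).trans (hb3.trans hv)
    have hmono : ∀ a ω₂, ω₂ <:+ ω₁ → T a ω₂ ≤ T a ω₁ := fun a ω₂ hs₂ =>
      le_of_suffix (T a) ω₁ (fun τ ω' hs => by
        rcases hstep ω hω τ ω' (hs.trans hs₁) a with h | ⟨h, -⟩ <;> omega) hs₂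
    have hsubopt : ∀ a, μ a + Δ ≤ V → T a ω₁ ≤ u := by
      intro a hga
      by_contra hlt
      obtain ⟨τ, ω₂, hs₂, he1, he2⟩ := exists_suffix_eq_of_lt (T a) (hT0 a) u ω₁
        (fun τ ω' hs => by
          rcases hstep ω hω τ ω' (hs.trans hs₁) a with h | ⟨h, -⟩ <;> omega) (not_le.1 hlt)
      have hs₂' : ω₂ <:+ ω₁ := (List.suffix_cons _ _).trans hs₂
      rcases hstep ω hω τ ω₂ (hs₂.trans hs₁) a with h | ⟨-, h | ⟨hpos, hidx⟩⟩
      · omega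
      · omega
      have hs1 : 1 ≤ T a₀ ω₂ := Nat.one_le_iff_ne_zero.2 (hpos a₀)
      have hsN : T a₀ ω₂ ≤ N := (hmono a₀ ω₂ hs₂').trans (hTN a₀)
      have hle : ∀ b, T b ω₂ ≤ ∑ i, T i ω₂ := fun b =>
        Finset.single_le_sum (f := fun a => T a ω₂) (fun _ _ => Nat.zero_le _)
          (Finset.mem_univ b)
      have hsumN : ∑ i, T i ω₂ ≤ N :=
        (Finset.sum_le_sum fun i _ => hmono i ω₂ hs₂').trans (hb3.trans hv)
      have hA := hn2 a ω₂ (hs₂'.trans hs₁) he1.le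
      have hB := hn3 (T a₀ ω₂) ⟨hs1, hsN⟩ ω₂ (hs₂'.trans hs₁) le_rfl
      rw [he1] at hA
      rw [ha₀] at hB
      have hcon := ucbIndex_lt_of_accurate hβ0 hξ (by linarith) hη hΔ hga hu1 hs1
        (max_le (by rw [← he1]; exact hle a) (hle a₀)) hsumN huN hA hB
      have := hidx a₀
      rw [he1] at this
      exact absurd this (not_le.2 hcon)
    -- Optimal arms are controlled by concentration and η ≤ e, suboptimal ones by the crude bound 2B
    -- per pull and at most `u` pulls.
    have hterm : ∀ a, |S a ω₁ - T a ω₁ * V| ≤ (1 + 4 * B * c₁) * ((N : ℝ) ^ e * y') := by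
      intro a
      rcases hgap a with hg | hg
      · have h1 := hn1 a ω₁ hs₁ (hTN a)
        rw [hg] at h1
        have h2 : (N : ℝ) ^ η * y' ≤ (N : ℝ) ^ e * y' :=
          mul_le_mul_of_nonneg_right (Real.rpow_le_rpow_of_exponent_le hN1 hηη) hy'0.le
        have h3 : 0 ≤ 4 * B * c₁ * ((N : ℝ) ^ e * y') := by positivity
        linarith
      · have h1 : (T a ω₁ : ℝ) ≤ u := by exact_mod_cast hsubopt a hg
        have h2 := hb1 a
        have h3 : 2 * B * T a ω₁ ≤ 2 * B * (2 * c₁ * ((N : ℝ) ^ e * y')) :=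
          mul_le_mul_of_nonneg_left (h1.trans hu_ge) (by positivity)
        linarith
    have hsum : |∑ a, (S a ω₁ - T a ω₁ * V)| ≤ k * ((1 + 4 * B * c₁) * ((N : ℝ) ^ e * y')) := by
      refine (Finset.abs_sum_le_sum_abs _ _).trans ((Finset.sum_le_sum fun a _ => hterm a).trans ?_)
      rw [Finset.sum_const, Finset.card_univ, hk, nsmul_eq_mul]
    have htot : |D ω₁| ≤ 2 * B + k * ((1 + 4 * B * c₁) * ((N : ℝ) ^ e * y')) := by
      have := abs_add_le (D ω₁ - ∑ a, (S a ω₁ - T a ω₁ * V)) (∑ a, (S a ω₁ - T a ω₁ * V))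
      rw [sub_add_cancel] at this
      linarith
    have hyG : (N : ℝ) ^ e * y = G * ((N : ℝ) ^ e * y') := by
      rw [hy']
      field_simp
    rw [hyG, hG] at hD
    have : 2 * B ≤ 2 * B * ((N : ℝ) ^ e * y') := le_mul_of_one_le_right (by positivity) hNy
    nlinarith
  have hα1 : -(α - 1) ≤ 0 := by linarith
  have e1 : C * y' ^ (-ξ) ≤ C * y' ^ (-(α - 1)) :=
    mul_le_mul_of_nonneg_left (Real.rpow_le_rpow_of_exponent_le hy1 (by linarith)) hC0
  -- Uses ξ(1-η) > α > α - 1 and u ≥ y'.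
  have e2 : C * ((u : ℝ) ^ (1 - η) * (Δ / 4)) ^ (-ξ) ≤
      C * (Δ / 4) ^ (-ξ) * y' ^ (-(α - 1)) := by
    rw [Real.mul_rpow (by positivity) (by positivity), ← Real.rpow_mul hu0.le, mul_assoc,
      mul_comm ((Δ / 4) ^ (-ξ))]
    gcongr
    calc (u : ℝ) ^ ((1 - η) * -ξ) ≤ (u : ℝ) ^ (-(α - 1)) :=
          Real.rpow_le_rpow_of_exponent_le hu1' (by linarith)
      _ ≤ y' ^ (-(α - 1)) := Real.rpow_le_rpow_of_nonpos hy'0 hyu hα1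
  have e3 : ∑ s ∈ Finset.Icc 1 N, C * (β ^ (1 / ξ) * ((max u s : ℕ) : ℝ) ^ (α / ξ)) ^ (-ξ) ≤
      2 * C * y' ^ (-(α - 1)) := by
    calc _ ≤ ∑ s ∈ Finset.Icc 1 N, C * ((max u s : ℕ) : ℝ) ^ (-α) := by
          refine Finset.sum_le_sum fun s _ => mul_le_mul_of_nonneg_left ?_ hC0
          rw [Real.mul_rpow (by positivity) (by positivity), ← Real.rpow_mul hβ0.le,
            ← Real.rpow_mul (Nat.cast_nonneg _), show α / ξ * -ξ = -α by field_simp]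
          refine mul_le_of_le_one_left (by positivity) ?_
          exact Real.rpow_le_one_of_one_le_of_nonpos hβ.le (by
            rw [one_div, mul_neg, inv_mul_cancel₀ hξ.ne']; norm_num)
      _ ≤ C * (2 * (u : ℝ) ^ (1 - α)) := by
          rw [← Finset.mul_sum]
          exact mul_le_mul_of_nonneg_left (sum_max_rpow_neg_le hα.le hu1 N) hC0
      _ ≤ C * (2 * y' ^ (-(α - 1))) := by
          rw [show 1 - α = -(α - 1) by ring]
          gcongr C * (2 * ?_)
          exact Real.rpow_le_rpow_of_nonpos hy'0 hyu hα1
      _ = _ := by ring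
  have m1 := p.toOuterMeasure_biUnion_le Finset.univ (fun a => bad a N y')
    (fun _ => C * y' ^ (-ξ)) (fun a _ => by positivity) fun a _ => harm a N y' hN hy'0
  have m2 := p.toOuterMeasure_biUnion_le Finset.univ
    (fun a => bad a u ((u : ℝ) ^ (1 - η) * (Δ / 4)))
    (fun _ => C * ((u : ℝ) ^ (1 - η) * (Δ / 4)) ^ (-ξ)) (fun a _ => by positivity)
    fun a _ => harm a u _ hu1 (by positivity)
  have m3 := p.toOuterMeasure_biUnion_le (Finset.Icc 1 N)
    (fun s => bad a₀ s (β ^ (1 / ξ) * ((max u s : ℕ) : ℝ) ^ (α / ξ)))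
    (fun s => C * (β ^ (1 / ξ) * ((max u s : ℕ) : ℝ) ^ (α / ξ)) ^ (-ξ))
    (fun s _ => by positivity) fun s hs => by
      have hm : (0 : ℝ) < ((max u s : ℕ) : ℝ) := by exact_mod_cast lt_max_of_lt_left hu1
      exact harm a₀ s _ (Finset.mem_Icc.1 hs).1 (by positivity)
  rw [Finset.sum_const, Finset.card_univ, hk, nsmul_eq_mul] at m1 m2
  refine (p.toOuterMeasure_mono hsub).trans ?_
  refine (MeasureTheory.measure_union_le _ _).trans ?_
  refine (add_le_add ((MeasureTheory.measure_union_le _ _).trans (add_le_add m1 m2)) m3).trans ?_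
  rw [← ENNReal.ofReal_add (by positivity) (by positivity),
    ← ENNReal.ofReal_add (by positivity) (Finset.sum_nonneg fun s _ => by positivity)]
  refine ENNReal.ofReal_le_ofReal ?_
  have f1 := mul_le_mul_of_nonneg_left e1 (Nat.cast_nonneg (α := ℝ) k)
  have f2 := mul_le_mul_of_nonneg_left e2 (Nat.cast_nonneg (α := ℝ) k)
  have f3 : 0 ≤ y' ^ (-(α - 1)) := by positivity
  rw [hC₁]
  linarith

/-! ### Admissible ranges of the level parameters -/

namespace LevelParams

variable {L : ℕ} {ξ η α : ℕ → ℝ}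

/-- The interval prescribed for α can be nonempty only if ξ(1-η)² > 0. -/
theorem xi_pos_of_eta (hp : LevelParams L ξ η α) {d : ℕ} (hd : d < L)
    (hη : η (d + 1) < 1) : 0 < ξ (d + 1) := by
  have h1 := hp.alpha_lower d hd
  have h2 := hp.alpha_upper d hd
  have h3 : 0 < ξ (d + 1) * (1 - η (d + 1)) ^ 2 := by nlinarith
  exact pos_of_mul_pos_left h3 (by positivity)

/-- The two bounds on α put the new η between the old one and 1, so η increases towards the root. -/
theorem eta_bounds (hp : LevelParams L ξ η α) {d : ℕ} (hd : d ≤ L) :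
    1 / 2 ≤ η d ∧ η d < 1 := by
  induction hd using Nat.decreasingInduction with
  | self => exact hp.eta_leaf
  | of_succ d hd ih =>
    have h1 := hp.alpha_lower d hd
    have h2 := hp.alpha_upper d hd
    have hξ := hp.xi_pos_of_eta hd ih.2
    have hpos : 0 < ξ (d + 1) * (1 - η (d + 1)) := mul_pos hξ (by linarith [ih.2])
    rw [hp.eta_step d hd, div_lt_one hpos, le_div_iff₀ hpos]
    refine ⟨le_trans ?_ h1, h2⟩
    nlinarith [ih.1]

theorem xi_pos (hp : LevelParams L ξ η α) {d : ℕ} (hd : d < L) : 0 < ξ (d + 1) :=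
  hp.xi_pos_of_eta hd (hp.eta_bounds hd).2

/-- Since 1 - η ≤ 1/2, α at one level is less than half of (α - 1) at the next deeper one. So α
grows with the depth, and the condition at level 1 suffices. -/
theorem two_lt_alpha (hp : LevelParams L ξ η α) {d : ℕ} (hd : d < L) : 2 < α (d + 1) := by
  induction d with
  | zero => exact hp.alpha_one
  | succ d ih =>
    have h1 := ih (by omega)
    have h2 := hp.alpha_upper d (by omega)
    have h3 := hp.xi_step (d + 1) hd
    have h4 := hp.xi_pos (d := d) (by omega)
    have h5 := (hp.eta_bounds (d := d + 1) (by omega)).1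
    nlinarith

end LevelParams

/-! ### Tail bounds for arms and nodes, and the backward induction -/

namespace POMDP

variable {X A Z : Type*}

/-- Polynomial tail bound, uniform in time, for the accumulated deviation of the returns at the
node `h`. -/
def NodeTail (M : POMDP X A Z) (ρ : History A Z → PMF A)
    (sel : SearchTree A Z → History A Z → PMF A) (L n : ℕ) (h : History A Z) (C η ξ : ℝ) : Prop :=
  ∀ (N : ℕ) (y : ℝ), 1 ≤ N → 0 < y → (M.searchLog ρ sel L n).toOuterMeasure
    {ω | ∃ ω', ω' <:+ ω ∧ (atNode h ω'.flatten).length ≤ N ∧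
      (N : ℝ) ^ η * y ≤ |M.nodeDev L h ω'.flatten|} ≤ ENNReal.ofReal (C * y ^ (-ξ))

/-- Polynomial tail bound, uniform in time, for the accumulated deviation of the returns of the
action `a` at the node `h`. -/
def ArmTail (M : POMDP X A Z) (ρ : History A Z → PMF A)
    (sel : SearchTree A Z → History A Z → PMF A) (L n : ℕ) (h : History A Z) (a : A)
    (C η ξ : ℝ) : Prop :=
  ∀ (N : ℕ) (y : ℝ), 1 ≤ N → 0 < y → (M.searchLog ρ sel L n).toOuterMeasure
    {ω | ∃ ω', ω' <:+ ω ∧ pulls a (atNode h ω'.flatten) ≤ N ∧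
      (N : ℝ) ^ η * y ≤ |M.armDev L h a ω'.flatten|} ≤ ENNReal.ofReal (C * y ^ (-ξ))

theorem abs_targetDev_le [Nonempty A] {M : POMDP X A Z} {R : ℝ}
    (hR : ∀ x a, |M.reward x a| ≤ R) {L : ℕ} {h : History A Z} (hL : h.length < L) (a : A)
    (x : X) (z : Z) : |M.targetDev L h a x z| ≤ 2 * M.horizonBound R L := by
  have hmono := M.horizonBound_mono (rewardBound_nonneg hR)
    (show L - h.length - 1 + 1 ≤ L by omega)
  have h1 := abs_reward_add_le hR (abs_optValue_le hR (L - h.length - 1) ((a, z) :: h)) x a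
  have h2 := abs_optQ_le hR (L - h.length - 1) h a
  unfold targetDev
  refine (abs_sub _ _).trans ?_
  linarith

/-- Concentration at the children of an arm yields concentration of the arm. -/
theorem exists_armTail {φ : ℝ} (hφ : 0 < φ) (Vmax : ℝ) {η ξ C : ℝ} (hη : 1 / 2 ≤ η) (hξ : 0 < ξ)
    (hC : 1 ≤ C) :
    ∃ C' : ℝ, 1 ≤ C' ∧ ∀ (X : Type*) (A : Type*) (Z : Type*) [Nonempty A] (M : POMDP X A Z)
      (R : ℝ) (ρ : History A Z → PMF A) (sel : SearchTree A Z → History A Z → PMF A) (L n : ℕ)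
      (h : History A Z) (a : A), (∀ x a, |M.reward x a| ≤ R) → M.horizonBound R L ≤ Vmax →
      h.length < L → (M.obsDist (M.belief h) a).support.Finite →
      (∀ z ∈ (M.obsDist (M.belief h) a).support, φ ≤ (M.obsDist (M.belief h) a z).toReal) →
      (∀ z ∈ (M.obsDist (M.belief h) a).support, M.NodeTail ρ sel L n ((a, z) :: h) C η ξ) →
      M.ArmTail ρ sel L n h a C' η ξ := by
  set c : ℝ := 2 * |Vmax| + 1 with hc
  have hc0 : 0 < c := by positivity
  obtain ⟨Ce, hCe0, hCe⟩ := exists_exp_neg_sq_le (1 / (2 * c ^ 2)) ξ (by positivity)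
  set K : ℕ := ⌊1 / φ⌋₊ with hK
  have hK1 : (1 : ℝ) ≤ K + 1 := by simp
  have hK0 : (0 : ℝ) < K + 1 := by positivity
  have hC0 : 0 ≤ C := by linarith
  -- The martingale and at most `K` children each receive the share y / (K + 1). The `+ 1` in the
  -- first factor covers y' < 1.
  refine ⟨(2 * Ce + K * C + 1) * (K + 1 : ℝ) ^ ξ, one_le_mul_of_one_le_of_one_le
    (by have : 0 ≤ 2 * Ce + K * C := by positivity
        linarith) (Real.one_le_rpow hK1 hξ.le), ?_⟩
  intro X A Z _ M R ρ sel L n h a hR hV hL hfin hφz hnode N y hN hy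
  have hN1 : (1 : ℝ) ≤ N := by exact_mod_cast hN
  have hN0 : (0 : ℝ) < N := by linarith
  set y' : ℝ := y / (K + 1) with hy'
  have hy'0 : 0 < y' := by positivity
  have hrw : (2 * Ce + K * C + 1) * (K + 1 : ℝ) ^ ξ * y ^ (-ξ) =
      (2 * Ce + K * C + 1) * y' ^ (-ξ) := by
    rw [hy', Real.div_rpow hy.le hK0.le, Real.rpow_neg hK0.le, div_inv_eq_mul]
    ring
  rw [hrw]
  have hyξ : 0 ≤ y' ^ (-ξ) := by positivity
  have hKC : 0 ≤ 2 * Ce + K * C := by positivity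
  rcases lt_or_ge y' 1 with hlt | hy1
  · refine (PMF.toOuterMeasure_le_one _ _).trans (ENNReal.one_le_ofReal.2 ?_)
    have := Real.one_le_rpow_of_pos_of_le_one_of_nonpos hy'0 hlt.le (by linarith : -ξ ≤ 0)
    nlinarith
  have hcard : (hfin.toFinset.card : ℝ) ≤ K := by
    exact_mod_cast PMF.finite_support_card_le _ hfin hφ hφz
  have hcD : ∀ x z, |M.targetDev L h a x z| ≤ c := fun x z => by
    have := abs_targetDev_le hR hL a x z
    have := le_abs_self Vmax
    linarith
  have hNη : 0 < (N : ℝ) ^ η := by positivity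
  set mart : Set (List (List (Visit X A Z))) :=
    {ω | ∃ ω', ω' <:+ ω ∧ pulls a (atNode h ω'.flatten) ≤ N ∧ (N : ℝ) ^ η * y' ≤
      |armSum a (fun x z _ => M.targetDev L h a x z) (atNode h ω'.flatten)|} with hmart
  set child : Z → Set (List (List (Visit X A Z))) := fun z =>
    {ω | ∃ ω', ω' <:+ ω ∧ (atNode ((a, z) :: h) ω'.flatten).length ≤ N ∧
      (N : ℝ) ^ η * y' ≤ |M.nodeDev L ((a, z) :: h) ω'.flatten|} with hchild
  have hsub : {ω | ∃ ω', ω' <:+ ω ∧ pulls a (atNode h ω'.flatten) ≤ N ∧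
      (N : ℝ) ^ η * y ≤ |M.armDev L h a ω'.flatten|} ∩ (M.searchLog ρ sel L n).support ⊆
      mart ∪ ⋃ z ∈ hfin.toFinset, child z := by
    rintro ω ⟨⟨ω', hs, hT, hdev⟩, hω⟩
    by_contra hnot
    simp only [Set.mem_union, Set.mem_iUnion, not_or, not_exists, hmart, hchild,
      Set.mem_ofPred_eq, not_and, not_le] at hnot
    obtain ⟨hn1, hn2⟩ := hnot
    have hlog := (isLog_of_mem_support hR L n ω hω).1.of_suffix hs
    have h1 := hn1 ω' hs hT
    have h2 : ∀ z ∈ hfin.toFinset, |M.nodeDev L ((a, z) :: h) ω'.flatten| ≤ (N : ℝ) ^ η * y' :=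
      fun z hz => (hn2 z hz ω' hs ((hlog.length_child_le h a z).trans hT)).le
    have h3 : |∑ z ∈ hfin.toFinset, M.nodeDev L ((a, z) :: h) ω'.flatten| ≤
        K * ((N : ℝ) ^ η * y') := by
      refine (Finset.abs_sum_le_sum_abs _ _).trans ((Finset.sum_le_sum h2).trans ?_)
      rw [Finset.sum_const, nsmul_eq_mul]
      exact mul_le_mul_of_nonneg_right hcard (by positivity)
    rw [hlog.armDev_eq h a (U := hfin.toFinset) (by simp)] at hdev
    have h4 := abs_add_le (armSum a (fun x z _ => M.targetDev L h a x z) (atNode h ω'.flatten))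
      (M.discount * ∑ z ∈ hfin.toFinset, M.nodeDev L ((a, z) :: h) ω'.flatten)
    rw [abs_mul, abs_of_nonneg M.discount_nonneg] at h4
    have h5 := mul_le_of_le_one_left
      (abs_nonneg (∑ z ∈ hfin.toFinset, M.nodeDev L ((a, z) :: h) ω'.flatten)) M.discount_le_one
    have h6 : (N : ℝ) ^ η * y = (K + 1) * ((N : ℝ) ^ η * y') := by
      rw [hy']
      field_simp
    rw [h6] at hdev
    linarith
  have m1 : (M.searchLog ρ sel L n).toOuterMeasure mart ≤
      ENNReal.ofReal (2 * (Ce * y' ^ (-ξ))) := by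
    refine (toOuterMeasure_exists_armSum_ge hR hc0 hcD hN (by positivity) n).trans
      (ENNReal.ofReal_le_ofReal ?_)
    refine mul_le_mul_of_nonneg_left (le_trans (Real.exp_le_exp.2 (neg_le_neg ?_))
      (hCe y' hy1)) zero_le_two
    -- Here η ≥ 1/2 enters: the Gaussian fluctuation √N does not exceed the scale N^η.
    have h1 : (N : ℝ) ≤ ((N : ℝ) ^ η) ^ 2 := by
      rw [← Real.rpow_natCast, ← Real.rpow_mul hN0.le]
      calc (N : ℝ) = (N : ℝ) ^ (1 : ℝ) := (Real.rpow_one _).symm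
        _ ≤ _ := Real.rpow_le_rpow_of_exponent_le hN1 (by push_cast; linarith)
    rw [mul_pow, le_div_iff₀ (by positivity)]
    calc 1 / (2 * c ^ 2) * y' ^ 2 * (2 * N * c ^ 2) = N * y' ^ 2 := by field_simp
      _ ≤ ((N : ℝ) ^ η) ^ 2 * y' ^ 2 := by gcongr
  have m2 := (M.searchLog ρ sel L n).toOuterMeasure_biUnion_le hfin.toFinset child
    (fun _ => C * y' ^ (-ξ)) (fun _ _ => by positivity)
    fun z hz => hnode z (hfin.mem_toFinset.1 hz) N y' hN hy'0
  rw [Finset.sum_const, nsmul_eq_mul] at m2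
  refine (PMF.toOuterMeasure_mono _ hsub).trans ((MeasureTheory.measure_union_le _ _).trans
    ((add_le_add m1 m2).trans ?_))
  rw [← ENNReal.ofReal_add (by positivity) (by positivity)]
  refine ENNReal.ofReal_le_ofReal ?_
  have := mul_le_mul_of_nonneg_right hcard (mul_nonneg hC0 hyξ)
  linarith

theorem IsLog.abs_armRet_le [Nonempty A] {M : POMDP X A Z}
    {sel : SearchTree A Z → History A Z → PMF A} {R : ℝ} (hR : ∀ x a, |M.reward x a| ≤ R) {L : ℕ}
    {ω : List (List (Visit X A Z))} (hω : IsLog M sel R L ω) (h : History A Z) (a : A) :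
    |armRet a (atNode h ω.flatten)| ≤
      M.horizonBound R L * pulls a (atNode h ω.flatten) := by
  classical
  induction hω with
  | nil => simp [atNode, armRet, pulls, armSum_nil]
  | cons τ ω hω hτ ih =>
    simp only [List.flatten_cons, atNode_append, armRet, pulls, armSum_append] at ih ⊢
    rcases hτ.atNode_cases hR h with ⟨h1, -⟩ | ⟨r, h1, -⟩ | ⟨x, b, z, r, s, h1, -, -, -, hr⟩
    · simpa [h1, armSum_nil] using ih
    · simpa [h1, armSum_none] using ih
    · rw [h1, armSum_some, armSum_some]
      split_ifs
      · refine (abs_add_le _ _).trans ?_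
        push_cast
        linarith
      · simpa using ih

/-- The actions chosen in a log maximize the corrected UCB index. -/
theorem IsLog.pulls_step [Fintype A] [Nonempty A] {M : POMDP X A Z}
    {sel : SearchTree A Z → History A Z → PMF A} {R : ℝ} (hR : ∀ x a, |M.reward x a| ≤ R) {L : ℕ}
    {β ξ η α : ℕ → ℝ} (hsel : IsCorrectedUCB L β ξ η α sel) {τ : List (Visit X A Z)}
    {ω : List (List (Visit X A Z))} (hω : IsLog M sel R L (τ :: ω)) {h : History A Z} {d : ℕ}
    (hd : h.length = d) (hL : d < L) (a : A) :
    pulls a (atNode h (τ :: ω).flatten) = pulls a (atNode h ω.flatten) ∨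
    (pulls a (atNode h (τ :: ω).flatten) = pulls a (atNode h ω.flatten) + 1 ∧
      (pulls a (atNode h ω.flatten) = 0 ∨ ((∀ b, pulls b (atNode h ω.flatten) ≠ 0) ∧ ∀ b,
        armRet b (atNode h ω.flatten) / pulls b (atNode h ω.flatten) +
          β (d + 1) ^ (1 / ξ (d + 1)) *
          ((∑ i, pulls i (atNode h ω.flatten) : ℕ) : ℝ) ^ (α (d + 1) / ξ (d + 1)) *
          (pulls b (atNode h ω.flatten) : ℝ) ^ (-(1 - η (d + 1))) ≤
        armRet a (atNode h ω.flatten) / pulls a (atNode h ω.flatten) +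
          β (d + 1) ^ (1 / ξ (d + 1)) *
          ((∑ i, pulls i (atNode h ω.flatten) : ℕ) : ℝ) ^ (α (d + 1) / ξ (d + 1)) *
          (pulls a (atNode h ω.flatten) : ℝ) ^ (-(1 - η (d + 1)))))) := by
  classical
  subst hd
  cases hω with
  | cons _ _ hω hτ =>
  have happ : pulls a (atNode h (τ :: ω).flatten) =
      pulls a (atNode h τ) + pulls a (atNode h ω.flatten) := by
    rw [List.flatten_cons, atNode_append, pulls, armSum_append]
    rfl
  rw [happ]
  rcases hτ.atNode_cases hR h with ⟨h1, -⟩ | ⟨r, h1, -⟩ | ⟨x, b, z, r, s, h1, h2, h3, -⟩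
  · left
    simp [h1, pulls, armSum_nil]
  · left
    simp [h1, pulls, armSum_none]
  · by_cases hb : b = a
    · subst hb
      right
      refine ⟨by simp [h1, pulls, armSum_some, add_comm], ?_⟩
      rcases hω.treeOf_eq hR h with ⟨h4, -⟩ | ⟨s', r', h4, -, hNa, hN, hQ, -⟩
      · rw [h2] at h4
        cases h4
      · rw [h2, Option.some_inj] at h4
        subst h4
        rcases hsel _ h s h2 hL b h3 with h5 | ⟨h5, h6⟩
        · left
          rw [← hNa, h5]
        · right
          refine ⟨fun b' => by rw [← hNa]; exact h5 b', fun b' => ?_⟩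
          have hq : ∀ c, armRet c (atNode h ω.flatten) / pulls c (atNode h ω.flatten) =
              s.Q c := fun c => by
            have : (s.Na c : ℝ) ≠ 0 := by exact_mod_cast h5 c
            rw [← hQ, ← hNa]
            field_simp
          rw [hq, hq, ← hN, ← hNa, ← hNa]
          exact h6 b'
    · left
      simp [h1, pulls, armSum_some, hb]

/-- Concentration at all nodes of a given depth, with a constant that depends only on the
parameters. -/
theorem exists_nodeTail (L k : ℕ) (Vmax φ Δ : ℝ) (hφ : 0 < φ) (hΔ : 0 < Δ)
    (β ξ η α : ℕ → ℝ) (hparams : LevelParams L ξ η α)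
    (hβ : ∀ h, 1 ≤ h → h ≤ L → 1 < β h) {d : ℕ} (hd : d ≤ L) :
    ∃ C : ℝ, 1 ≤ C ∧
      ∀ (X : Type*) (A : Type*) (Z : Type*) [Fintype A] [Nonempty A] (M : POMDP X A Z) (R : ℝ),
        Fintype.card A = k → (∀ x a, |M.reward x a| ≤ R) → M.horizonBound R L ≤ Vmax →
        M.ObsSupport L φ → M.GapAtLeast L Δ →
        ∀ (ρ : History A Z → PMF A) (sel : SearchTree A Z → History A Z → PMF A),
          IsCorrectedUCB L β ξ η α sel → ∀ (n : ℕ) (h : History A Z), M.Reachable h →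
            h.length = d → M.NodeTail ρ sel L n h C (η d) (ξ d) := by
  induction hd using Nat.decreasingInduction with
  | self =>
    -- Leaves have no deviation, so the event is empty and any constant works.
    refine ⟨1, le_rfl, ?_⟩
    intro X A Z _ _ M R _ hR _ _ _ ρ sel _ n h _ hlen N y hN hy
    refine le_trans (PMF.toOuterMeasure_mono _ (t := ∅) ?_) (by simp)
    rintro ω ⟨⟨ω', hs, -, hdev⟩, hω⟩
    have hlog := (isLog_of_mem_support hR L n ω hω).1.of_suffix hs
    rw [nodeDev_eq_zero L (hlog.atNode_leaf hlen.ge), abs_zero] at hdev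
    have hN0 : (0 : ℝ) < N := by exact_mod_cast hN
    exact absurd hdev (not_le.2 (by positivity))
  | of_succ d hd ih =>
    obtain ⟨C, hC, hchild⟩ := ih
    obtain ⟨hη1, hη2⟩ := hparams.eta_bounds hd
    have hξ := hparams.xi_pos hd
    obtain ⟨C', hC', harm⟩ := exists_armTail hφ Vmax hη1 hξ hC
    obtain ⟨C₀, hC₀, hbandit⟩ := exists_bandit_tail k (abs_nonneg Vmax) hΔ
      (hβ (d + 1) (by omega) hd) hξ (by linarith) hη2 (hparams.two_lt_alpha hd)
      (hparams.alpha_lower d hd) (hparams.alpha_upper d hd) hC'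
    refine ⟨C₀, hC₀, ?_⟩
    intro X A Z _ _ M R hk hR hV hobs hgap ρ sel hsel n h hreach hlen
    have hlt : h.length < L := by omega
    have hsucc : L - h.length = L - h.length - 1 + 1 := by omega
    have hgap' := hgap h hreach hlt
    have hVB : |M.optValue (L - h.length) h| ≤ |Vmax| :=
      (abs_optValue_le hR _ _).trans ((M.horizonBound_mono (rewardBound_nonneg hR)
        (Nat.sub_le _ _)).trans (hV.trans (le_abs_self _)))
    have hVa : M.horizonBound R L ≤ |Vmax| := hV.trans (le_abs_self _)
    have hopt : ∃ a, M.optQ (L - h.length - 1) h a = M.optValue (L - h.length) h := by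
      obtain ⟨a, ha⟩ := exists_optValue_le_optQ hR (L - h.length - 1) h
      rw [← hsucc] at ha
      -- The gap hypothesis turns V^* ≤ Q^* into equality, without gluing policies of the children.
      refine ⟨a, (hgap' a).resolve_right fun h' => ?_⟩
      linarith
    have hlog : ∀ ω ∈ (M.searchLog ρ sel L n).support, ∀ ω', ω' <:+ ω → IsLog M sel R L ω' :=
      fun ω hω ω' hs => (isLog_of_mem_support hR L n ω hω).1.of_suffix hs
    rw [hparams.eta_step d hd, hparams.xi_step d hd]
    refine hbandit hk (M.searchLog ρ sel L n) (fun a ω => pulls a (atNode h ω.flatten))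
      (fun a ω => armRet a (atNode h ω.flatten)) (fun ω => (atNode h ω.flatten).length)
      (fun ω => M.nodeDev L h ω.flatten) (fun a => M.optQ (L - h.length - 1) h a)
      (M.optValue (L - h.length) h) hopt hgap' (fun a => rfl)
      (fun ω hω τ ω' hs a => (hlog ω hω _ hs).pulls_step hR hsel hlen hd a)
      (fun ω hω ω' hs => ?_) (fun a => ?_)
    · have hl := hlog ω hω ω' hs
      refine ⟨fun a => ?_, ?_⟩
      · have h1 := hl.abs_armRet_le hR h a
        have h2 : (0 : ℝ) ≤ pulls a (atNode h ω'.flatten) := Nat.cast_nonneg _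
        refine (abs_sub _ _).trans ?_
        rw [abs_mul, abs_of_nonneg h2]
        nlinarith
      · rcases hl.treeOf_eq hR h with ⟨-, h1⟩ | ⟨s, r, -, hr, -, -, -, hlen', hret⟩
        · simp [h1, nodeDev, retSum, armRet, pulls, armSum_nil]
        · refine ⟨?_, by omega⟩
          rw [nodeDev, hlen', hret, Finset.sum_sub_distrib, ← Finset.sum_mul]
          push_cast
          -- What remains is the expanding visit, a rollout return minus V^*.
          rw [show ∀ a b c v : ℝ, a + c - (b + 1) * v - (a - b * v) = c - v by intros; ring]
          refine (abs_sub _ _).trans ?_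
          linarith
    · obtain ⟨hfin, hφz⟩ := hobs h hreach hlt a
      exact harm X A Z M R ρ sel L n h a hR hV hlt hfin hφz fun z hz =>
        hchild X A Z M R hk hR hV hobs hgap ρ sel hsel n ((a, z) :: h) ⟨hreach, hz⟩ (by simp [hlen])

end POMDP

theorem theorem1
    (L k : ℕ) (Vmax φ Δ : ℝ) (hφ : 0 < φ) (hΔ : 0 < Δ)
    (β ξ η α : ℕ → ℝ) (hparams : LevelParams L ξ η α)
    (hβ : ∀ h, 1 ≤ h → h ≤ L → 1 < β h) :
    ∃ β₀ : ℝ, 1 < β₀ ∧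
      ∀ (X : Type*) (A : Type*) (Z : Type*) [Fintype A] [Nonempty A] (M : POMDP X A Z) (Rmax : ℝ),
        Fintype.card A = k →
        (∀ x a, |M.reward x a| ≤ Rmax) →
        Rmax * ∑ i ∈ Finset.range L, M.discount ^ i ≤ Vmax →
        M.ObsSupport L φ →
        M.GapAtLeast L Δ →
        ∀ (ρ : History A Z → PMF A) (sel : SearchTree A Z → History A Z → PMF A),
          IsCorrectedUCB L β ξ η α sel →
          ∀ (n : ℕ) (z : ℝ), 1 ≤ n → 1 ≤ z →
            (M.valueEstimate ρ sel L n).toMeasure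
                {v : ℝ | (n : ℝ) * (v - M.optValue L []) ≥ (n : ℝ) ^ η 0 * z}
              ≤ ENNReal.ofReal (β₀ * z ^ (-ξ 0)) ∧
            (M.valueEstimate ρ sel L n).toMeasure
                {v : ℝ | (n : ℝ) * (v - M.optValue L []) ≤ -((n : ℝ) ^ η 0 * z)}
              ≤ ENNReal.ofReal (β₀ * z ^ (-ξ 0)) := by
  obtain ⟨C, hC, htail⟩ := POMDP.exists_nodeTail L k Vmax φ Δ hφ hΔ β ξ η α hparams hβ
    (Nat.zero_le L)
  -- The tail bound provides only C ≥ 1, while the claim asks for a strict inequality.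
  refine ⟨C + 1, by linarith, ?_⟩
  intro X A Z _ _ M Rmax hk hR hV hobs hgap ρ sel hsel n z hn hz
  have hn0 : (0 : ℝ) < n := by exact_mod_cast hn
  have hz0 : 0 < z := by linarith
  have key : ∀ s : Set ℝ, MeasurableSet s →
      (∀ v ∈ s, (n : ℝ) ^ η 0 * z ≤ |(n : ℝ) * (v - M.optValue L [])|) →
      (M.valueEstimate ρ sel L n).toMeasure s ≤ ENNReal.ofReal ((C + 1) * z ^ (-ξ 0)) := by
    intro s hs hsub
    rw [PMF.toMeasure_apply_eq_toOuterMeasure_apply _ hs, POMDP.valueEstimate,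
      POMDP.search_eq_map_searchLog, PMF.map_comp, PMF.toOuterMeasure_map_apply]
    refine le_trans (PMF.toOuterMeasure_mono _ ?_)
      ((htail X A Z M Rmax hk hR hV hobs hgap ρ sel hsel n [] trivial rfl n z hn hz0).trans
        (ENNReal.ofReal_le_ofReal (by gcongr; linarith)))
    rintro ω ⟨hωs, hω⟩
    obtain ⟨hlog, hlen⟩ := POMDP.isLog_of_mem_support hR L n ω hω
    have hdev := hsub _ hωs
    -- For L = 0 the root is itself a leaf and has no recorded visits, so `root_stats` does not
    -- apply; all returns are zero.
    rcases Nat.eq_zero_or_pos L with rfl | hL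
    · have hzero : (ω.map POMDP.traceReturn).sum = 0 := by
        clear hωs hω hlen hdev
        induction hlog with
        | nil => rfl
        | cons τ ω hω hτ ih =>
          cases hτ
          simpa [POMDP.traceReturn] using ih
      simp only [Function.comp_apply, hzero, POMDP.optValue_zero] at hdev
      have : 0 < (n : ℝ) ^ η 0 * z := by positivity
      simp at hdev
      linarith
    · obtain ⟨h1, h2⟩ := hlog.root_stats hL
      refine ⟨ω, List.suffix_rfl, by rw [h1, hlen], hdev.trans (le_of_eq ?_)⟩
      rw [POMDP.nodeDev, h1, h2, hlen]
      simp only [Function.comp_apply, List.length_nil, Nat.sub_zero]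
      congr 1
      field_simp
  refine ⟨key _ (measurableSet_le (by fun_prop) (by fun_prop)) fun v hv => ?_,
    key _ (measurableSet_le (by fun_prop) (by fun_prop)) fun v hv => ?_⟩
  · exact le_trans hv (le_abs_self _)
  · exact le_trans (le_neg_of_le_neg hv) (neg_le_abs _)
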